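/- Let $n\ge 1$ and let $\omega$ be a weight on $\mathbb R^n$, i.e. a locally integrable function with $\omega>0$ almost everywhere; write $\omega(E)=\int_E\omega\,dx$. Cubes have sides parallel to the axes and positive side length. For a measurable function $f$ put $f^*(t)=\inf\{s>0:\omega(\{|f|>s\})\le t\}$ and, for $1<p<\infty$, $$\|f\|_{L^{p,1}_\omega}=\frac1p\int_0^\infty t^{1/p}f^*(t)\,\frac{dt}{t},\qquad \|f\|_{L^{p,\infty}_\omega}=\sup_{t>0}t^{1/p}f^*(t).$$ For $1<q<p<\infty$ put $$\|f\|_{M^p_{q,\omega}}=\sup_Q\Big(\frac1{\omega(Q)^{1-q/p}}\int_Q|f|^q\omega\,dx\Big)^{1/q},\qquad \|f\|_{WM^p_{q,\omega}}=\sup_Q\frac{1}{\omega(Q)^{1/q-1/p}}\sup_{\lambda>0}\lambda\,\omega(\{x\in Q:|f(x)|>\lambda\})^{1/q},$$ the suprema being over all cubes $Q$. The spaces $L^{p,1}_\omega$, $L^{p,\infty}_\omega$ consist of the measurable functions of finite norm, and $M^p_{q,\omega}$, $WM^p_{q,\omega}$ of the functions in $L^q_{\omega,\mathrm{loc}}$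 of finite norm. For each of these spaces $X$, $X(\ell^r)$ is the set of sequences $\vec f=(f_k)_{k\ge1}$ of measurable functions with $|\vec f|_r=(\sum_k|f_k|^r)^{1/r}\in X$, with norm $\|\vec f\|_{X(\ell^r)}=\|\,|\vec f|_r\|_X$. Let $Mf(x)=\sup_{Q\ni x}\frac1{|Q|}\int_Q|f|\,dy$ (supremum over cubes containing $x$) and $M\vec f=(Mf_k)_k$; $M$ is bounded from $X(\ell^r)$ to $Y(\ell^r)$ if there is a constant $C$ such that for all $\vec f\in X(\ell^r)$ one has $M\vec f\in Y(\ell^r)$ and $\|M\vec f\|_{Y(\ell^r)}\le C\|\vec f\|_{X(\ell^r)}$. Finally $\omega\in A(p,1)$ means that there is a constant $C$ with $$\|\chi_Q\|_{L^{p,1}_\omega}\,\|\chi_Q\,\omega^{-1}\|_{L^{p',\infty}_\omega}\le C|Q|\quad\text{for every cube }Q,\qquad p'=\tfrac{p}{p-1}.$$ **Theorem.** Let $1<q<p<r<\infty$. The following statements are equivalent: 1. $\omega\in A(p,1)$; 2. $M$ is bounded from $L^{p,1}_\omega(\ell^r)$ to $L^{p,\infty}_\omega(\ell^r)$; 3.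 $M$ is bounded from $L^{p,1}_\omega(\ell^r)$ to $M^p_{q,\omega}(\ell^r)$; 4. $M$ is bounded from $L^{p,1}_\omega(\ell^r)$ to $WM^p_{q,\omega}(\ell^r)$. -/

import Mathlib

open MeasureTheory Set
open scoped ENNReal NNReal

noncomputable section

namespace WeightedMaximal

/-- The underlying set of `ℝⁿ`, with its Lebesgue measure `volume`. No norm of `ℝⁿ` is used: only
the topology, Lebesgue measure and cubes with sides parallel to the axes. -/
abbrev Rn (n : ℕ) : Type := Fin n → ℝ

variable {n : ℕ}

/-- The cube (sides parallel to the axes) with lower corner `a` and side length `l`. -/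
def cube (a : Rn n) (l : ℝ) : Set (Rn n) := {y | ∀ i, a i ≤ y i ∧ y i ≤ a i + l}

/-- `Q` is a nondegenerate cube. -/
def IsCube (Q : Set (Rn n)) : Prop := ∃ (a : Rn n) (l : ℝ), 0 < l ∧ Q = cube a l

/-- A weight: a locally integrable function which is positive almost everywhere. -/
structure IsWeight (ω : Rn n → ℝ) : Prop where
  locallyIntegrable : LocallyIntegrable ω volume
  pos_ae : ∀ᵐ x ∂(volume : Measure (Rn n)), 0 < ω x

/-- The measure `ω(x) dx`. -/
def wMeasure (ω : Rn n → ℝ) : Measure (Rn n) :=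
  volume.withDensity fun x => ENNReal.ofReal (ω x)

/-- The distribution function `d_f(s) = ω({x : f(x) > s})`. -/
def distrib (ω : Rn n → ℝ) (f : Rn n → ℝ≥0∞) (s : ℝ≥0∞) : ℝ≥0∞ :=
  wMeasure ω {x | s < f x}

/-- The decreasing rearrangement `f^*(t) = inf {s > 0 : d_f(s) ≤ t}` with respect to `ω(x) dx`. -/
def rearrangement (ω : Rn n → ℝ) (f : Rn n → ℝ≥0∞) (t : ℝ≥0∞) : ℝ≥0∞ :=
  sInf {s : ℝ≥0∞ | 0 < s ∧ distrib ω f s ≤ t}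

/-- The Lorentz functional `‖f‖_{L^{p,q}_ω}`, for `0 < p < ∞` and `0 < q ≤ ∞`:
`(q/p ∫₀^∞ [t^{1/p} f^*(t)]^q dt/t)^{1/q}` if `q < ∞`, and `sup_{t>0} t^{1/p} f^*(t)` if `q = ∞`. -/
def lorentzNorm (ω : Rn n → ℝ) (p : ℝ) (q : ℝ≥0∞) (f : Rn n → ℝ≥0∞) : ℝ≥0∞ :=
  open scoped Classical in
  if q = ∞ then
    ⨆ (t : ℝ≥0) (_ : 0 < t), (t : ℝ≥0∞) ^ (1 / p) * rearrangement ω f t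
  else
    (ENNReal.ofReal (q.toReal / p) *
      ∫⁻ t in Ioi (0 : ℝ),
        (ENNReal.ofReal t ^ (1 / p) * rearrangement ω f (ENNReal.ofReal t)) ^ q.toReal
          / ENNReal.ofReal t) ^ (1 / q.toReal)

/-- Membership of (the absolute value of) a function in `L^{p,q}_ω`. -/
def MemLorentz (ω : Rn n → ℝ) (p : ℝ) (q : ℝ≥0∞) (f : Rn n → ℝ≥0∞) : Prop :=
  AEMeasurable f volume ∧ lorentzNorm ω p q f < ∞

/-- Membership of (the absolute value of) a function in `L^q_{ω,loc}`. -/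
def MemLpLoc (ω : Rn n → ℝ) (q : ℝ) (f : Rn n → ℝ≥0∞) : Prop :=
  AEMeasurable f volume ∧
    ∀ K : Set (Rn n), IsCompact K → ∫⁻ x in K, f x ^ q ∂(wMeasure ω) < ∞

/-- The norm of the weighted Morrey space `M^p_{q,ω} = 𝓛^{q,κ}_ω` with `κ = 1 - q/p`:
`sup_Q (ω(Q)^{-κ} ∫_Q |f|^q ω dx)^{1/q}`. -/
def morreyNorm (ω : Rn n → ℝ) (p q : ℝ) (f : Rn n → ℝ≥0∞) : ℝ≥0∞ :=
  ⨆ (Q : Set (Rn n)) (_ : IsCube Q),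
    ((∫⁻ x in Q, f x ^ q ∂(wMeasure ω)) / wMeasure ω Q ^ (1 - q / p)) ^ (1 / q)

/-- Membership of (the absolute value of) a function in `M^p_{q,ω}`. -/
def MemMorrey (ω : Rn n → ℝ) (p q : ℝ) (f : Rn n → ℝ≥0∞) : Prop :=
  MemLpLoc ω q f ∧ morreyNorm ω p q f < ∞

/-- The norm of the weighted weak Morrey space `WM^p_{q,ω}`:
`sup_Q ω(Q)^{-(1/q-1/p)} sup_{s>0} s ω({x ∈ Q : |f(x)| > s})^{1/q}`. -/
def weakMorreyNorm (ω : Rn n → ℝ) (p q : ℝ) (f : Rn n → ℝ≥0∞) : ℝ≥0∞ :=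
  ⨆ (Q : Set (Rn n)) (_ : IsCube Q),
    (⨆ (s : ℝ≥0) (_ : 0 < s),
      (s : ℝ≥0∞) * wMeasure ω {x | x ∈ Q ∧ (s : ℝ≥0∞) < f x} ^ (1 / q))
      / wMeasure ω Q ^ (1 / q - 1 / p)

/-- Membership of (the absolute value of) a function in `WM^p_{q,ω}`. -/
def MemWeakMorrey (ω : Rn n → ℝ) (p q : ℝ) (f : Rn n → ℝ≥0∞) : Prop :=
  MemLpLoc ω q f ∧ weakMorreyNorm ω p q f < ∞

/-- The class `A(p,1)`: there is a constant `C` with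
`‖χ_Q‖_{L^{p,1}_ω} ‖χ_Q ω⁻¹‖_{L^{p',∞}_ω} ≤ C |Q|` for all cubes `Q`, where `p' = p/(p-1)`. -/
def IsAp1 (p : ℝ) (ω : Rn n → ℝ) : Prop :=
  ∃ C : ℝ≥0, 0 < C ∧ ∀ Q : Set (Rn n), IsCube Q →
    lorentzNorm ω p 1 (Q.indicator fun _ => 1) *
      lorentzNorm ω (p / (p - 1)) ∞ (Q.indicator fun x => (ENNReal.ofReal (ω x))⁻¹)
      ≤ C * volume Q

/-- The (uncentred, cubic) Hardy-Littlewood maximal function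
`M f(x) = sup_{Q ∋ x} |Q|⁻¹ ∫_Q |f(y)| dy`. -/
def maximal (f : Rn n → ℂ) (x : Rn n) : ℝ≥0∞ :=
  ⨆ (Q : Set (Rn n)) (_ : IsCube Q) (_ : x ∈ Q), (∫⁻ y in Q, ‖f y‖ₑ) / volume Q

/-- `|F(x)|_r = (∑ₖ F_k(x)^r)^{1/r}`. -/
def ellr (r : ℝ) (F : ℕ → Rn n → ℝ≥0∞) (x : Rn n) : ℝ≥0∞ :=
  (∑' k, F k x ^ r) ^ (1 / r)

/-- The operator `(f_k) ↦ (M f_k)` is bounded from `X(ℓ^r)` to `Y(ℓ^r)`, where the spaces `X`, `Y`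
are given by a membership predicate and a norm (both applied to absolute values of functions), and
`X(ℓ^r)` is the set of all sequences of measurable functions with `|f|_r ∈ X`, with norm
`‖ |f|_r ‖_X`. -/
def MaximalBounded (r : ℝ)
    (MemX : (Rn n → ℝ≥0∞) → Prop) (normX : (Rn n → ℝ≥0∞) → ℝ≥0∞)
    (MemY : (Rn n → ℝ≥0∞) → Prop) (normY : (Rn n → ℝ≥0∞) → ℝ≥0∞) : Prop :=
  ∃ C : ℝ≥0, 0 < C ∧ ∀ f : ℕ → Rn n → ℂ, (∀ k, AEMeasurable (f k) volume) →
    MemX (ellr r fun k x => ‖f k x‖ₑ) →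
      (∀ k, AEMeasurable (maximal (f k)) volume) ∧
      MemY (ellr r fun k => maximal (f k)) ∧
      normY (ellr r fun k => maximal (f k)) ≤ C * normX (ellr r fun k x => ‖f k x‖ₑ)

end WeightedMaximal

end

/-!
All four statements are equivalent to a *restricted bound* for the measure `μ = ω dx`:
`|E| / |Q| ≤ K (μ(E) / μ(Q)) ^ (1/p)` for measurable subsets `E` of cubes `Q` (`RestrictedBound`).

The restricted bound is the `A(p,1)` condition. In one direction, Kolmogorov's inequality
`lintegral_le_of_weak_bound` bounds `|E| = ∫_E ω⁻¹ dμ` by the weak `L^{p'}` norm of `χ_Q ω⁻¹`; in the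
other, `s μ(E) ≤ |E|` on `E = Q ∩ {ω⁻¹ > s}`. It is necessary for the weakest boundedness property,
since `M χ_E ≥ |E| / |Q|` on `Q`. Among the target spaces, `L^{p,∞} ⊆ M^p_q ⊆ WM^p_q` by Kolmogorov's
and Chebyshev's inequalities. It remains to show that the restricted bound implies the weak type
inequality from `L^{p,1}(ℓ^r)` to `L^{p,∞}(ℓ^r)`.

*Scalar inequalities.* The restricted bound makes `μ` doubling, so a Vitali covering argument
(`measure_lt_avgMax_le`) gives the restricted weak type `(p, 1)` (`weak_type_avgMax`) and the weak type
`(t, t)` for all `t > p` (`weak_type_avgMax_of_lt`); by interpolation `M` is bounded on `L^r(μ)`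
(`strong_type_avgMax`), hence on `L^r(ℓ^r)`.

*Vector-valued inequality.* Let `g = |f|_r` and `U = {M g > l}`, an open set with
`μ(U) ≲ (‖g‖_{L^{p,1}} / l) ^ p` by the scalar inequality. In `U` each `f k` is replaced by its average
over a cube whose side is the distance to the complement of `U`, giving `h k` (`whitneyAvg`). This is
a substitute for the Calderón–Zygmund decomposition which needs no dyadic cubes: `|h|_r ≲ l` on `U` by
Minkowski's inequality, `|h|_r = g ≤ l` almost everywhere off `U`, and `M (f k) ≲ M (h k)` off `U` by
Fubini's theorem (`avgMax_le_avgMax_whitneyAvg`). Chebyshev's inequality and the bound on `L^r(ℓ^r)`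
applied to `h` finish the proof (`weak_type_ellr_avgMax`).
-/

noncomputable section

namespace WeightedMaximal

/-! ### Layer cake formulas for `ℝ≥0∞`-valued functions -/

theorem lintegral_Ioo_rpow_sub_one {a : ℝ} (ha : 0 < a) {b : ℝ} (hb : 0 ≤ b) :
    ∫⁻ s in Ioo (0 : ℝ) b, ENNReal.ofReal (a * s ^ (a - 1)) = ENNReal.ofReal (b ^ a) := by
  have hi : IntervalIntegrable (fun s : ℝ => a * s ^ (a - 1)) volume 0 b :=
    (intervalIntegral.intervalIntegrable_rpow' (by linarith)).const_mul a
  rw [intervalIntegrable_iff_integrableOn_Ioo_of_le hb] at hi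
  rw [← ofReal_integral_eq_lintegral_ofReal hi]
  · rw [← integral_Ioc_eq_integral_Ioo, ← intervalIntegral.integral_of_le hb,
      intervalIntegral.integral_const_mul, integral_rpow (Or.inl (by linarith))]
    congr 1
    have : a - 1 + 1 = a := by ring
    rw [this, Real.zero_rpow ha.ne']
    field_simp
    ring
  · filter_upwards [ae_restrict_mem measurableSet_Ioo] with s hs
    have := hs.1
    positivity

/-- Writing `y ^ a` as an integral over the levels below `y`. With Tonelli's theorem this is the
source of all layer cake formulas below. -/
theorem lintegral_Ioi_indicator_rpow {a : ℝ} (ha : 0 < a) (y : ℝ≥0∞) :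
    ∫⁻ s in Ioi (0 : ℝ),
      {s : ℝ | ENNReal.ofReal s < y}.indicator (fun s => ENNReal.ofReal (a * s ^ (a - 1))) s
      = y ^ a := by
  rw [lintegral_indicator (measurableSet_lt (by fun_prop) measurable_const),
    Measure.restrict_restrict (measurableSet_lt (by fun_prop) measurable_const)]
  by_cases hy : y = ∞
  · subst hy
    rw [ENNReal.top_rpow_of_pos ha]
    refine ENNReal.eq_top_of_forall_nnreal_le fun b => ?_
    have hb : (b : ℝ≥0∞) = ENNReal.ofReal ((b : ℝ) ^ (1 / a)) ^ a := by
      rw [ENNReal.ofReal_rpow_of_nonneg (by positivity) ha.le, ← Real.rpow_mul b.coe_nonneg]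
      simp [ha.ne']
    rw [hb, ENNReal.ofReal_rpow_of_nonneg (by positivity) ha.le,
      ← lintegral_Ioo_rpow_sub_one ha (by positivity : (0 : ℝ) ≤ (b : ℝ) ^ (1 / a))]
    refine lintegral_mono_set fun s hs => ?_
    exact ⟨ENNReal.ofReal_lt_top, hs.1⟩
  · have : {s : ℝ | ENNReal.ofReal s < y} ∩ Ioi 0 = Ioo 0 y.toReal := by
      ext s
      simp only [mem_inter_iff, mem_ofPred_eq, mem_Ioi, mem_Ioo]
      constructor
      · rintro ⟨h1, h2⟩
        exact ⟨h2, (ENNReal.ofReal_lt_iff_lt_toReal h2.le hy).1 h1⟩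
      · rintro ⟨h1, h2⟩
        exact ⟨(ENNReal.ofReal_lt_iff_lt_toReal h1.le hy).2 h2, h1⟩
    rw [this, lintegral_Ioo_rpow_sub_one ha ENNReal.toReal_nonneg,
      ← ENNReal.ofReal_rpow_of_nonneg ENNReal.toReal_nonneg ha.le, ENNReal.ofReal_toReal hy]

/-- The layer cake formula, with infinite values allowed. -/
theorem lintegral_rpow_eq_lintegral_distrib {α : Type*} [MeasurableSpace α] (μ : Measure α)
    [SFinite μ] {f : α → ℝ≥0∞} (hf : Measurable f) {a : ℝ} (ha : 0 < a) :
    ∫⁻ x, f x ^ a ∂μ =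
      ∫⁻ s in Ioi (0 : ℝ), ENNReal.ofReal (a * s ^ (a - 1)) * μ {x | ENNReal.ofReal s < f x} := by
  simp_rw [← lintegral_Ioi_indicator_rpow ha (f _)]
  rw [lintegral_lintegral_swap]
  · refine lintegral_congr fun s => ?_
    have : ∀ x, {s : ℝ | ENNReal.ofReal s < f x}.indicator
        (fun s => ENNReal.ofReal (a * s ^ (a - 1))) s =
        {x | ENNReal.ofReal s < f x}.indicator (fun _ => ENNReal.ofReal (a * s ^ (a - 1))) x := by
      intro x; simp [indicator]
    simp_rw [this]
    rw [lintegral_indicator_const (measurableSet_lt measurable_const hf)]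
  · have hS : MeasurableSet {z : α × ℝ | ENNReal.ofReal z.2 < f z.1} :=
      measurableSet_lt (by fun_prop) (by fun_prop)
    have : Measurable ({z : α × ℝ | ENNReal.ofReal z.2 < f z.1}.indicator
        fun z => ENNReal.ofReal (a * z.2 ^ (a - 1))) := Measurable.indicator (by fun_prop) hS
    exact this.aemeasurable

theorem lintegral_eq_lintegral_distrib {α : Type*} [MeasurableSpace α] (μ : Measure α)
    [SFinite μ] {f : α → ℝ≥0∞} (hf : Measurable f) :
    ∫⁻ x, f x ∂μ = ∫⁻ s in Ioi (0 : ℝ), μ {x | ENNReal.ofReal s < f x} := by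
  simpa using lintegral_rpow_eq_lintegral_distrib μ hf one_pos

theorem lintegral_Ioi_rpow_neg {a : ℝ} (ha : 1 < a) {b : ℝ} (hb : 0 < b) :
    ∫⁻ s in Ioi b, ENNReal.ofReal (s ^ (-a)) = ENNReal.ofReal (b ^ (1 - a) / (a - 1)) := by
  rw [← ofReal_integral_eq_lintegral_ofReal (integrableOn_Ioi_rpow_of_lt (by linarith) hb),
    integral_Ioi_rpow_of_lt (by linarith) hb]
  · congr 1
    have h1 : -a + 1 = 1 - a := by ring
    have h2 : 1 - a ≠ 0 := by linarith
    have h3 : a - 1 ≠ 0 := by linarith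
    rw [h1]
    field_simp
    ring
  · filter_upwards [ae_restrict_mem measurableSet_Ioi] with s hs
    have : 0 < s := hb.trans hs
    positivity

/-- **Kolmogorov's inequality**: a weak `L^a` bound with `a > 1` on a finite measure space gives an
`L^1` bound. -/
theorem lintegral_le_of_weak_bound {α : Type*} [MeasurableSpace α] (μ : Measure α)
    [IsFiniteMeasure μ] {f : α → ℝ≥0∞} (hf : Measurable f) {a : ℝ} (ha : 1 < a) {N : ℝ≥0∞}
    (h : ∀ s : ℝ, 0 < s → ENNReal.ofReal s ^ a * μ {x | ENNReal.ofReal s < f x} ≤ N) :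
    ∫⁻ x, f x ∂μ ≤ ENNReal.ofReal (a / (a - 1)) * (N ^ (1 / a) * μ univ ^ (1 - 1 / a)) := by
  have ha0 : 0 < a := by linarith
  have ha1 : 0 < a - 1 := by linarith
  have hexp : 0 < 1 - 1 / a := by
    have : 1 / a < 1 := by rw [div_lt_one ha0]; exact ha
    linarith
  rcases eq_or_ne (μ univ) 0 with hm | hm
  · rw [Measure.measure_univ_eq_zero.1 hm]; simp
  rcases eq_or_ne N ∞ with hN | hN
  · subst hN
    rw [ENNReal.top_rpow_of_pos (by positivity), ENNReal.top_mul, ENNReal.mul_top]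
    · exact le_top
    · simpa using div_pos ha0 ha1
    · simp [ENNReal.rpow_eq_zero_iff, hm]
  rw [lintegral_eq_lintegral_distrib μ hf]
  rcases eq_or_ne N 0 with hN0 | hN0
  · subst hN0
    have : ∫⁻ s in Ioi (0 : ℝ), μ {x | ENNReal.ofReal s < f x} = ∫⁻ s in Ioi (0 : ℝ), 0 := by
      refine setLIntegral_congr_fun measurableSet_Ioi fun s hs => ?_
      have := h s hs
      simp only [nonpos_iff_eq_zero, mul_eq_zero, ENNReal.rpow_eq_zero_iff] at this
      rcases this with h | h
      · rcases h with h | h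
        · exact absurd h.1 (by simpa using hs)
        · exact absurd h.2 (by linarith)
      · exact h
    rw [this]; simp
  -- the two bounds `μ univ` and `N s ^ (-a)` for the distribution function agree at `s = b`
  obtain ⟨m, hm'⟩ : ∃ m : ℝ, 0 < m ∧ μ univ = ENNReal.ofReal m :=
    ⟨(μ univ).toReal, ENNReal.toReal_pos hm (measure_ne_top _ _),
      (ENNReal.ofReal_toReal (measure_ne_top _ _)).symm⟩
  obtain ⟨hm0, hm'⟩ := hm'
  obtain ⟨M, hM0, rfl⟩ : ∃ M : ℝ, 0 < M ∧ N = ENNReal.ofReal M :=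
    ⟨N.toReal, ENNReal.toReal_pos hN0 hN, (ENNReal.ofReal_toReal hN).symm⟩
  set b : ℝ := (M / m) ^ (1 / a) with hb
  have hb0 : 0 < b := by positivity
  have hsplit : Ioi (0 : ℝ) = Ioc 0 b ∪ Ioi b := (Ioc_union_Ioi_eq_Ioi hb0.le).symm
  have h1 : ∫⁻ s in Ioc (0 : ℝ) b, μ {x | ENNReal.ofReal s < f x}
      ≤ ENNReal.ofReal m * ENNReal.ofReal b := by
    calc _ ≤ ∫⁻ s in Ioc (0 : ℝ) b, ENNReal.ofReal m := by
          refine lintegral_mono fun s => ?_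
          rw [← hm']; exact measure_mono (subset_univ _)
      _ = _ := by simp
  have h2 : ∫⁻ s in Ioi b, μ {x | ENNReal.ofReal s < f x}
      ≤ ENNReal.ofReal M * ENNReal.ofReal (b ^ (1 - a) / (a - 1)) := by
    rw [← lintegral_Ioi_rpow_neg ha hb0, ← lintegral_const_mul _ (by fun_prop)]
    refine setLIntegral_mono (by fun_prop) fun s hs => ?_
    have hs0 : 0 < s := hb0.trans hs
    rw [Real.rpow_neg hs0.le, ENNReal.ofReal_inv_of_pos (by positivity), ← div_eq_mul_inv,
      ← ENNReal.ofReal_rpow_of_pos hs0]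
    rw [ENNReal.le_div_iff_mul_le, mul_comm]
    · exact h s hs0
    · left; simp [ENNReal.rpow_eq_zero_iff, hs0, ha0.not_gt]
    · left; simp [ENNReal.rpow_eq_top_iff, ha0.not_gt]
  rw [hsplit]
  refine (lintegral_union_le _ _ _).trans ((add_le_add h1 h2).trans (le_of_eq ?_))
  rw [hm', ENNReal.ofReal_rpow_of_pos hM0, ENNReal.ofReal_rpow_of_pos hm0,
    ← ENNReal.ofReal_mul hm0.le, ← ENNReal.ofReal_mul hM0.le, ← ENNReal.ofReal_mul (by positivity),
    ← ENNReal.ofReal_mul (by positivity), ← ENNReal.ofReal_add (by positivity) (by positivity)]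
  congr 1
  have e1 : m * b = M ^ (1 / a) * m ^ (1 - 1 / a) := by
    rw [hb, Real.div_rpow hM0.le hm0.le, Real.rpow_sub hm0, Real.rpow_one]; field_simp
  have e2 : M * b ^ (1 - a) = m * b := by
    have hba : b ^ a = M / m := by
      rw [hb, ← Real.rpow_mul (by positivity)]; simp [ha0.ne']
    rw [Real.rpow_sub hb0, hba, Real.rpow_one]; field_simp
  rw [← mul_div_assoc, e2, ← e1]
  field_simp
  ring

/-! ### Lorentz norms in terms of distribution functions -/

variable {n : ℕ} {ω : Rn n → ℝ}

theorem distrib_antitone (ω : Rn n → ℝ) (f : Rn n → ℝ≥0∞) : Antitone (distrib ω f) :=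
  fun _ _ h => measure_mono fun _ hx => lt_of_le_of_lt h hx

theorem distrib_congr {f g : Rn n → ℝ≥0∞} (h : f =ᵐ[volume] g) : distrib ω f = distrib ω g := by
  funext s
  refine measure_congr ?_
  filter_upwards [(withDensity_absolutelyContinuous _ _).ae_le h] with x hx
  change (s < f x) = (s < g x)
  rw [hx]

theorem lorentzNorm_congr {f g : Rn n → ℝ≥0∞} (h : f =ᵐ[volume] g) (p : ℝ) (q : ℝ≥0∞) :
    lorentzNorm ω p q f = lorentzNorm ω p q g := by
  have : rearrangement ω f = rearrangement ω g := by
    funext t; simp only [rearrangement, distrib_congr h]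
  simp only [lorentzNorm, this]

/-- The rearrangement and the distribution function are generalized inverses of each other. -/
theorem lt_rearrangement_iff (ω : Rn n → ℝ) (f : Rn n → ℝ≥0∞) (s t : ℝ≥0∞) :
    s < rearrangement ω f t ↔ t < distrib ω f s := by
  constructor
  · intro h
    by_contra! hc
    have hle : ∀ u, s < u → rearrangement ω f t ≤ u := fun u hu =>
      sInf_le ⟨hu.bot_lt, (distrib_antitone ω f hu.le).trans hc⟩
    exact absurd (le_of_forall_gt_imp_ge_of_dense hle) h.not_ge
  · intro h
    have hs : s ≠ ∞ := by
      rintro rfl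
      simp [distrib] at h
    -- right continuity of the distribution function
    have hU : {x | s < f x} = ⋃ m : ℕ, {x | s + ((m : ℝ≥0∞) + 1)⁻¹ < f x} := by
      ext x
      simp only [mem_ofPred_eq, mem_iUnion]
      constructor
      · intro hx
        obtain ⟨m, hm⟩ := ENNReal.exists_inv_nat_lt (tsub_pos_of_lt hx).ne'
        refine ⟨m, ?_⟩
        have : ((m : ℝ≥0∞) + 1)⁻¹ < f x - s :=
          lt_of_le_of_lt (ENNReal.inv_le_inv.2 le_self_add) hm
        exact lt_tsub_iff_left.1 this
      · rintro ⟨m, hm⟩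
        exact le_self_add.trans_lt hm
    have hmono : Monotone fun m : ℕ => {x | s + ((m : ℝ≥0∞) + 1)⁻¹ < f x} := by
      intro m k hmk x (hx : s + ((m : ℝ≥0∞) + 1)⁻¹ < f x)
      refine lt_of_le_of_lt (b := s + ((m : ℝ≥0∞) + 1)⁻¹) ?_ hx
      gcongr
    rw [distrib, hU, hmono.measure_iUnion, lt_iSup_iff] at h
    obtain ⟨m, hm⟩ := h
    refine lt_of_lt_of_le (b := s + ((m : ℝ≥0∞) + 1)⁻¹) ?_ ?_
    · exact ENNReal.lt_add_right hs (by simp)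
    · refine le_sInf fun u hu => ?_
      by_contra! hc
      exact absurd (hm.trans_le (distrib_antitone ω f hc.le)) hu.2.not_gt

/-- `‖f‖_{L^{p,1}} = ∫₀^∞ d_f(s)^{1/p} ds`: integrate over the region `{(s, t) | t < d_f(s)}` in the
other order. -/
theorem lorentzNorm_one (ω : Rn n → ℝ) {p : ℝ} (hp : 0 < p) (f : Rn n → ℝ≥0∞) :
    lorentzNorm ω p 1 f = ∫⁻ s in Ioi (0 : ℝ), distrib ω f (ENNReal.ofReal s) ^ (1 / p) := by
  have hp' : (0 : ℝ) < 1 / p := by positivity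
  have hd : Measurable fun s : ℝ => distrib ω f (ENNReal.ofReal s) :=
    (distrib_antitone ω f).measurable.comp ENNReal.measurable_ofReal
  have key : ∀ t ∈ Ioi (0 : ℝ), ENNReal.ofReal (1 / p) *
      ((ENNReal.ofReal t ^ (1 / p) * rearrangement ω f (ENNReal.ofReal t)) ^ (1 : ℝ)
        / ENNReal.ofReal t) =
      ∫⁻ s in Ioi (0 : ℝ), {t : ℝ | ENNReal.ofReal t < distrib ω f (ENNReal.ofReal s)}.indicator
        (fun t => ENNReal.ofReal (1 / p * t ^ (1 / p - 1))) t := by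
    intro t ht
    have ht : 0 < t := ht
    have h1 := lintegral_Ioi_indicator_rpow one_pos (rearrangement ω f (ENNReal.ofReal t))
    simp only [sub_self, Real.rpow_zero, mul_one, ENNReal.ofReal_one, ENNReal.rpow_one] at h1
    rw [ENNReal.rpow_one, ENNReal.mul_div_right_comm, ← mul_assoc, ← h1]
    have h2 : ENNReal.ofReal (1 / p) * (ENNReal.ofReal t ^ (1 / p) / ENNReal.ofReal t) =
        ENNReal.ofReal (1 / p * t ^ (1 / p - 1)) := by
      rw [ENNReal.ofReal_rpow_of_pos ht, ← ENNReal.ofReal_div_of_pos ht,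
        ← ENNReal.ofReal_mul hp'.le, Real.rpow_sub ht, Real.rpow_one]
    rw [h2, ← lintegral_const_mul' _ _ ENNReal.ofReal_ne_top]
    refine lintegral_congr fun s => ?_
    simp only [indicator, mem_ofPred_eq, lt_rearrangement_iff]
    split_ifs <;> simp
  rw [lorentzNorm, if_neg ENNReal.one_ne_top, ENNReal.toReal_one, div_one, ENNReal.rpow_one,
    ← lintegral_const_mul' _ _ ENNReal.ofReal_ne_top, setLIntegral_congr_fun measurableSet_Ioi key,
    lintegral_lintegral_swap]
  · refine lintegral_congr fun s => ?_
    exact lintegral_Ioi_indicator_rpow hp' _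
  · have hS : MeasurableSet {z : ℝ × ℝ | ENNReal.ofReal z.1 < distrib ω f (ENNReal.ofReal z.2)} :=
      measurableSet_lt (by fun_prop) (hd.comp measurable_snd)
    have : Measurable ({z : ℝ × ℝ | ENNReal.ofReal z.1 < distrib ω f (ENNReal.ofReal z.2)}.indicator
        fun z => ENNReal.ofReal (1 / p * z.1 ^ (1 / p - 1))) := Measurable.indicator (by fun_prop) hS
    exact this.aemeasurable

/-- `‖f‖_{L^{p,∞}} = sup_{s > 0} s d_f(s)^{1/p}`. -/
theorem lorentzNorm_top_le_iff (ω : Rn n → ℝ) {p : ℝ} (hp : 0 < p) (f : Rn n → ℝ≥0∞) (N : ℝ≥0∞) :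
    lorentzNorm ω p ∞ f ≤ N ↔
      ∀ s : ℝ, 0 < s → ENNReal.ofReal s * distrib ω f (ENNReal.ofReal s) ^ (1 / p) ≤ N := by
  have hp' : (0 : ℝ) < 1 / p := by positivity
  rw [lorentzNorm, if_pos rfl]
  constructor
  · intro h s hs
    have hs0 : ENNReal.ofReal s ≠ 0 := by simpa using hs
    have hle : distrib ω f (ENNReal.ofReal s) ≤ (N / ENNReal.ofReal s) ^ p := by
      refine ENNReal.le_of_forall_nnreal_lt fun t ht => ?_
      rcases eq_or_ne t 0 with rfl | ht0
      · simp
      have h1 := (iSup₂_le_iff.1 h) t ht0.bot_lt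
      have h2 := ((lt_rearrangement_iff ω f _ _).2 ht).le
      rw [← ENNReal.rpow_inv_le_iff hp, ENNReal.le_div_iff_mul_le (Or.inl hs0)
        (Or.inl ENNReal.ofReal_ne_top), ← one_div]
      exact (mul_le_mul_right h2 _).trans h1
    rw [mul_comm, ← ENNReal.le_div_iff_mul_le (Or.inl hs0) (Or.inl ENNReal.ofReal_ne_top),
      one_div, ENNReal.rpow_inv_le_iff hp]
    exact hle
  · intro h
    refine iSup₂_le fun t ht => ?_
    have ht0 : (t : ℝ≥0∞) ^ (1 / p) ≠ 0 := by
      simp [ENNReal.rpow_eq_zero_iff, ht.ne']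
    have ht1 : (t : ℝ≥0∞) ^ (1 / p) ≠ ∞ := ENNReal.rpow_ne_top_of_nonneg hp'.le ENNReal.coe_ne_top
    rw [mul_comm, ← ENNReal.le_div_iff_mul_le (Or.inl ht0) (Or.inl ht1)]
    refine ENNReal.le_of_forall_nnreal_lt fun s hs => ?_
    rcases eq_or_ne s 0 with rfl | hs0
    · simp
    rw [ENNReal.le_div_iff_mul_le (Or.inl ht0) (Or.inl ht1)]
    have h1 := h s (by positivity)
    rw [ENNReal.ofReal_coe_nnreal] at h1
    refine le_trans ?_ h1
    gcongr
    exact ((lt_rearrangement_iff ω f _ _).1 hs).le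

/-! ### The maximal function of a nonnegative function -/

/-- The maximal function over cubes of a nonnegative function; `maximal f` is `avgMax ‖f‖ₑ`. -/
def avgMax (g : Rn n → ℝ≥0∞) (x : Rn n) : ℝ≥0∞ :=
  ⨆ (Q : Set (Rn n)) (_ : IsCube Q) (_ : x ∈ Q), (∫⁻ y in Q, g y) / volume Q

theorem maximal_eq_avgMax (f : Rn n → ℂ) : maximal f = avgMax fun x => ‖f x‖ₑ := rfl

theorem avgMax_congr {f g : Rn n → ℝ≥0∞} (h : f =ᵐ[volume] g) : avgMax f = avgMax g := by
  funext x
  simp only [avgMax]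
  refine iSup_congr fun Q => ?_
  rw [lintegral_congr_ae (ae_restrict_of_ae h)]

theorem cube_eq_closedBall (a : Rn n) {l : ℝ} (hl : 0 < l) :
    cube a l = Metric.closedBall (fun i => a i + l / 2) (l / 2) := by
  ext y
  rw [Metric.mem_closedBall, dist_pi_le_iff (by positivity)]
  simp only [cube, mem_ofPred_eq, Real.dist_eq, abs_le]
  refine forall_congr' fun i => ?_
  constructor <;> rintro ⟨h1, h2⟩ <;> constructor <;> linarith

theorem isCube_iff (Q : Set (Rn n)) :
    IsCube Q ↔ ∃ (c : Rn n) (R : ℝ), 0 < R ∧ Q = Metric.closedBall c R := by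
  constructor
  · rintro ⟨a, l, hl, rfl⟩
    exact ⟨_, l / 2, by positivity, cube_eq_closedBall a hl⟩
  · rintro ⟨c, R, hR, rfl⟩
    refine ⟨fun i => c i - R, 2 * R, by positivity, ?_⟩
    rw [cube_eq_closedBall _ (by positivity)]
    congr 1
    · funext i; ring
    · ring

theorem volume_closedBall_eq (c : Rn n) {R : ℝ} (hR : 0 ≤ R) :
    volume (Metric.closedBall c R) = ENNReal.ofReal ((2 * R) ^ n) := by
  rw [Real.volume_pi_closedBall c hR, Fintype.card_fin]

theorem volume_closedBall_pos (c : Rn n) {R : ℝ} (hR : 0 < R) :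
    0 < volume (Metric.closedBall c R) := by
  rw [volume_closedBall_eq c hR.le]; simp; positivity

theorem volume_closedBall_ne_top (c : Rn n) (R : ℝ) :
    volume (Metric.closedBall c R) ≠ ∞ := measure_closedBall_lt_top.ne

theorem volume_closedBall_mul (c : Rn n) {R b : ℝ} (hR : 0 ≤ R) (hb : 0 ≤ b) :
    volume (Metric.closedBall c (b * R)) =
      ENNReal.ofReal (b ^ n) * volume (Metric.closedBall c R) := by
  rw [volume_closedBall_eq c hR, volume_closedBall_eq c (by positivity),
    ← ENNReal.ofReal_mul (by positivity), ← mul_pow]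
  congr 2; ring

/-- Slightly enlarging a cube changes its average by little, so a point where the maximal function
exceeds `l` is *interior* to a cube with average above `l`. -/
theorem lt_avgMax_iff (g : Rn n → ℝ≥0∞) (l : ℝ≥0∞) (x : Rn n) :
    l < avgMax g x ↔ ∃ (c : Rn n) (R : ℝ), 0 < R ∧ x ∈ Metric.ball c R ∧
      l * volume (Metric.closedBall c R) < ∫⁻ y in Metric.closedBall c R, g y := by
  simp only [avgMax, lt_iSup_iff]
  constructor
  · rintro ⟨Q, hQ, hx, hl⟩
    obtain ⟨c, R, hR, rfl⟩ := (isCube_iff Q).1 hQ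
    have hlt : l ≠ ∞ := hl.ne_top
    rw [ENNReal.lt_div_iff_mul_lt (Or.inl (volume_closedBall_pos c hR).ne')
      (Or.inl (volume_closedBall_ne_top c R)), volume_closedBall_eq c hR.le] at hl
    have hcont : Continuous fun R' : ℝ => l * ENNReal.ofReal ((2 * R') ^ n) :=
      (ENNReal.continuous_const_mul hlt).comp
        (ENNReal.continuous_ofReal.comp (by fun_prop))
    have hev := hcont.continuousAt.eventually_lt (x₀ := R) continuousAt_const hl
    obtain ⟨e, he, hball⟩ := Metric.eventually_nhds_iff.1 hev
    have hR' : 0 < R + e / 2 := by positivity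
    refine ⟨c, R + e / 2, hR', ?_, ?_⟩
    · exact Metric.closedBall_subset_ball (by linarith) hx
    · rw [volume_closedBall_eq c hR'.le]
      refine (hball (y := R + e / 2) ?_).trans_le
        (lintegral_mono_set (Metric.closedBall_subset_closedBall (by linarith)))
      rw [Real.dist_eq, abs_of_pos] <;> linarith
  · rintro ⟨c, R, hR, hx, hl⟩
    refine ⟨_, (isCube_iff _).2 ⟨c, R, hR, rfl⟩, Metric.ball_subset_closedBall hx, ?_⟩
    rwa [ENNReal.lt_div_iff_mul_lt (Or.inl (volume_closedBall_pos c hR).ne')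
      (Or.inl (volume_closedBall_ne_top c R))]

theorem isOpen_lt_avgMax (g : Rn n → ℝ≥0∞) (l : ℝ≥0∞) : IsOpen {x | l < avgMax g x} := by
  rw [isOpen_iff_forall_mem_open]
  intro x hx
  obtain ⟨c, R, hR, hxc, hl⟩ := (lt_avgMax_iff g l x).1 hx
  exact ⟨Metric.ball c R, fun y hy => (lt_avgMax_iff g l y).2 ⟨c, R, hR, hy, hl⟩,
    Metric.isOpen_ball, hxc⟩

theorem measurable_avgMax (g : Rn n → ℝ≥0∞) : Measurable (avgMax g) :=
  measurable_of_Ioi fun l => (isOpen_lt_avgMax g l).measurableSet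

theorem setLIntegral_le_avgMax_mul (g : Rn n → ℝ≥0∞) {c x : Rn n} {R : ℝ} (hR : 0 < R)
    (hx : x ∈ Metric.closedBall c R) :
    ∫⁻ y in Metric.closedBall c R, g y ≤ avgMax g x * volume (Metric.closedBall c R) := by
  rw [← ENNReal.div_le_iff_le_mul (Or.inl (volume_closedBall_pos c hR).ne')
      (Or.inl (volume_closedBall_ne_top c R))]
  exact le_iSup_of_le _ (le_iSup_of_le ((isCube_iff _).2 ⟨c, R, hR, rfl⟩)
    (le_iSup_of_le hx le_rfl))

theorem avgMax_le {g : Rn n → ℝ≥0∞} {x : Rn n} {l : ℝ≥0∞}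
    (h : ∀ (c : Rn n) (R : ℝ), 0 < R → x ∈ Metric.closedBall c R →
      ∫⁻ y in Metric.closedBall c R, g y ≤ l * volume (Metric.closedBall c R)) :
    avgMax g x ≤ l := by
  refine iSup_le fun Q => iSup_le fun hQ => iSup_le fun hx => ?_
  obtain ⟨c, R, hR, rfl⟩ := (isCube_iff Q).1 hQ
  exact ENNReal.div_le_of_le_mul (h c R hR hx)

/-! ### Weak and strong type inequalities under a restricted bound -/

/-- The `A(p,1)` condition in the form that is used: on every cube `Q`,
`|E| / |Q| ≤ K (μ(E) / μ(Q)) ^ (1/p)` for measurable `E ⊆ Q`. -/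
def RestrictedBound (μ : Measure (Rn n)) (p : ℝ) (K : ℝ≥0) : Prop :=
  ∀ (c : Rn n) (R : ℝ), 0 < R → ∀ E, MeasurableSet E → E ⊆ Metric.closedBall c R →
    volume E * μ (Metric.closedBall c R) ^ (1 / p)
      ≤ K * volume (Metric.closedBall c R) * μ E ^ (1 / p)

theorem RestrictedBound.doubling {μ : Measure (Rn n)} {p : ℝ} (hp : 0 < p) {K : ℝ≥0}
    (h : RestrictedBound μ p K) (c : Rn n) {R : ℝ} (hR : 0 < R) :
    μ (Metric.closedBall c (5 * R)) ≤ ((K * 5 ^ n : ℝ≥0) : ℝ≥0∞) ^ p * μ (Metric.closedBall c R) := by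
  have h1 := h c (5 * R) (by positivity) (Metric.closedBall c R)
    Metric.isClosed_closedBall.measurableSet (Metric.closedBall_subset_closedBall (by linarith))
  rw [volume_closedBall_mul c hR.le (by norm_num), ← mul_assoc, mul_comm _ (volume _),
    mul_assoc] at h1
  have h2 := (ENNReal.mul_le_mul_iff_right (volume_closedBall_pos c hR).ne'
    (volume_closedBall_ne_top c R)).1 h1
  have h3 := ENNReal.rpow_le_rpow h2 hp.le
  rw [ENNReal.mul_rpow_of_nonneg _ _ hp.le, ← ENNReal.rpow_mul, ← ENNReal.rpow_mul,
    one_div_mul_cancel hp.ne', ENNReal.rpow_one, ENNReal.rpow_one] at h3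
  convert h3 using 3
  rw [ENNReal.ofReal_pow (by norm_num)]
  push_cast
  norm_num

/-- A Vitali covering argument: to bound a superlevel set of the maximal function it suffices to
bound the measure of finite disjoint families of cubes with large average. -/
theorem measure_lt_avgMax_le (μ : Measure (Rn n)) [IsLocallyFiniteMeasure μ] {D W l : ℝ≥0∞}
    (hD : ∀ (c : Rn n) (R : ℝ), 0 < R →
      μ (Metric.closedBall c (5 * R)) ≤ D * μ (Metric.closedBall c R))
    (g : Rn n → ℝ≥0∞)
    (hW : ∀ t : Finset (Rn n × ℝ),
      (t : Set (Rn n × ℝ)).PairwiseDisjoint (fun i => Metric.closedBall i.1 i.2) →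
      (∀ i ∈ t, 0 < i.2 ∧ l * volume (Metric.closedBall i.1 i.2)
        < ∫⁻ y in Metric.closedBall i.1 i.2, g y) →
      ∑ i ∈ t, μ (Metric.closedBall i.1 i.2) ≤ W) :
    μ {x | l < avgMax g x} ≤ D * W := by
  rw [(isOpen_lt_avgMax g l).measure_eq_iSup_isCompact]
  refine iSup₂_le fun K hK => iSup_le fun hKc => ?_
  set P : Set (Rn n × ℝ) := {i | 0 < i.2 ∧ l * volume (Metric.closedBall i.1 i.2)
        < ∫⁻ y in Metric.closedBall i.1 i.2, g y} with hP
  obtain ⟨T, hTP, hTfin, hTK⟩ := hKc.elim_finite_subcover_image (b := P)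
    (c := fun i => Metric.ball i.1 i.2) (fun i _ => Metric.isOpen_ball) (by
      intro x hx
      obtain ⟨c, R, hR, hxc, hl⟩ := (lt_avgMax_iff g l x).1 (hK hx)
      exact mem_biUnion (show (c, R) ∈ P from ⟨hR, hl⟩) hxc)
  obtain ⟨R0, hR0⟩ := (hTfin.image Prod.snd).bddAbove
  obtain ⟨u, huT, hdisj, hcov⟩ := Vitali.exists_disjoint_subfamily_covering_enlargement_closedBall
    T Prod.fst Prod.snd R0 (fun a ha => hR0 (mem_image_of_mem _ ha)) 5 (by norm_num)
  have hufin : u.Finite := hTfin.subset huT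
  have hKu : K ⊆ ⋃ i ∈ hufin.toFinset, Metric.closedBall i.1 (5 * i.2) := by
    intro x hx
    obtain ⟨i, hi, hxi⟩ := mem_iUnion₂.1 (hTK hx)
    obtain ⟨j, hj, hij⟩ := hcov i hi
    exact mem_biUnion (by simpa using hj) (hij (Metric.ball_subset_closedBall hxi))
  calc μ K ≤ ∑ i ∈ hufin.toFinset, μ (Metric.closedBall i.1 (5 * i.2)) :=
        (measure_mono hKu).trans (measure_biUnion_finset_le _ _)
    _ ≤ ∑ i ∈ hufin.toFinset, D * μ (Metric.closedBall i.1 i.2) := by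
        refine Finset.sum_le_sum fun i hi => hD _ _ ?_
        exact (hTP (huT (by simpa using hi))).1
    _ = D * ∑ i ∈ hufin.toFinset, μ (Metric.closedBall i.1 i.2) := by rw [Finset.mul_sum]
    _ ≤ D * W := by
        gcongr
        refine hW _ (by simpa using hdisj) fun i hi => hTP (huT (by simpa using hi))

theorem setLIntegral_eq_lintegral_distrib {g : Rn n → ℝ≥0∞} (hg : Measurable g) (Q : Set (Rn n)) :
    ∫⁻ y in Q, g y = ∫⁻ s in Ioi (0 : ℝ), volume ({x | ENNReal.ofReal s < g x} ∩ Q) := by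
  rw [lintegral_eq_lintegral_distrib _ hg]
  refine lintegral_congr fun s => ?_
  rw [Measure.restrict_apply (measurableSet_lt measurable_const hg)]

theorem measurable_distrib_rpow (μ : Measure (Rn n)) (g : Rn n → ℝ≥0∞) (Q : Set (Rn n)) (a : ℝ) :
    Measurable fun s : ℝ => μ ({x | ENNReal.ofReal s < g x} ∩ Q) ^ a := by
  have : Antitone fun s : ℝ => μ ({x | ENNReal.ofReal s < g x} ∩ Q) := fun s t h =>
    measure_mono fun x hx => ⟨(ENNReal.ofReal_le_ofReal h).trans_lt hx.1, hx.2⟩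
  exact this.measurable.pow_const a

/-- The restricted weak type `(p, 1)` inequality for the maximal function. Testing a disjoint family
of cubes, the local bounds are summed by Hölder's inequality under the integral over levels. -/
theorem weak_type_avgMax (μ : Measure (Rn n)) [IsLocallyFiniteMeasure μ] {p : ℝ} (hp : 1 < p)
    {K : ℝ≥0} (h : RestrictedBound μ p K) {g : Rn n → ℝ≥0∞} (hg : Measurable g) {l : ℝ≥0∞}
    (hl0 : l ≠ 0) (hl : l ≠ ∞) :
    μ {x | l < avgMax g x} ≤ ((K * 5 ^ n : ℝ≥0) : ℝ≥0∞) ^ p *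
      (K * (∫⁻ s in Ioi (0 : ℝ), μ {x | ENNReal.ofReal s < g x} ^ (1 / p)) / l) ^ p := by
  have hp0 : 0 < p := by linarith
  set N := ∫⁻ s in Ioi (0 : ℝ), μ {x | ENNReal.ofReal s < g x} ^ (1 / p) with hN
  refine measure_lt_avgMax_le μ (fun c R hR => h.doubling hp0 c hR) g fun t htd ht => ?_
  set B : Rn n × ℝ → Set (Rn n) := fun i => Metric.closedBall i.1 i.2 with hB
  have hBm : ∀ i, MeasurableSet (B i) := fun i => Metric.isClosed_closedBall.measurableSet
  have hsm : ∀ s : ℝ, MeasurableSet {x | ENNReal.ofReal s < g x} := fun s =>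
    measurableSet_lt measurable_const hg
  set S := ∑ i ∈ t, μ (B i) with hS
  have hSt : S ≠ ∞ := by
    rw [hS, ENNReal.sum_ne_top]
    exact fun i _ => measure_closedBall_lt_top.ne
  have hloc : ∀ i ∈ t, l * μ (B i) ^ (1 / p) ≤
      K * ∫⁻ s in Ioi (0 : ℝ), μ ({x | ENNReal.ofReal s < g x} ∩ B i) ^ (1 / p) := by
    intro i hi
    obtain ⟨hR, hi'⟩ := ht i hi
    have hv0 := (volume_closedBall_pos i.1 hR).ne'
    have hv1 := volume_closedBall_ne_top i.1 i.2
    rw [← ENNReal.mul_le_mul_iff_right hv0 hv1]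
    calc volume (B i) * (l * μ (B i) ^ (1 / p))
        = l * volume (B i) * μ (B i) ^ (1 / p) := by ring
      _ ≤ (∫⁻ y in B i, g y) * μ (B i) ^ (1 / p) := by gcongr
      _ = ∫⁻ s in Ioi (0 : ℝ), volume ({x | ENNReal.ofReal s < g x} ∩ B i) * μ (B i) ^ (1 / p) := by
          rw [setLIntegral_eq_lintegral_distrib hg, lintegral_mul_const]
          simpa using measurable_distrib_rpow volume g (B i) 1
      _ ≤ ∫⁻ s in Ioi (0 : ℝ), K * volume (B i) *
            μ ({x | ENNReal.ofReal s < g x} ∩ B i) ^ (1 / p) :=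
          lintegral_mono fun s => h _ _ hR _ ((hsm s).inter (hBm i)) inter_subset_right
      _ = _ := by
          rw [lintegral_const_mul _ (measurable_distrib_rpow μ g _ _)]
          ring
  have hconj : (p / (p - 1)).HolderConjugate p := (Real.HolderConjugate.conjExponent hp).symm
  have hpp : 1 / (p / (p - 1)) = 1 - 1 / p := by field_simp
  have hpp0 : 0 < 1 - 1 / p := by
    have : 1 / p < 1 := by rw [div_lt_one hp0]; exact hp
    linarith
  have hmain : l * S ≤ K * N * S ^ (1 - 1 / p) := by
    calc l * S = ∑ i ∈ t, μ (B i) ^ (1 - 1 / p) * (l * μ (B i) ^ (1 / p)) := by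
          rw [hS, Finset.mul_sum]
          refine Finset.sum_congr rfl fun i _ => ?_
          rw [mul_left_comm, ← ENNReal.rpow_add_of_nonneg _ _ hpp0.le (by positivity)]
          simp
      _ ≤ ∑ i ∈ t, μ (B i) ^ (1 - 1 / p) *
          (K * ∫⁻ s in Ioi (0 : ℝ), μ ({x | ENNReal.ofReal s < g x} ∩ B i) ^ (1 / p)) := by
          refine Finset.sum_le_sum fun i hi => ?_
          exact mul_le_mul_right (hloc i hi) _
      _ = K * ∫⁻ s in Ioi (0 : ℝ), ∑ i ∈ t, μ (B i) ^ (1 - 1 / p) *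
            μ ({x | ENNReal.ofReal s < g x} ∩ B i) ^ (1 / p) := by
          rw [lintegral_finsetSum _ fun i _ => (measurable_distrib_rpow μ g _ _).const_mul _,
            Finset.mul_sum]
          refine Finset.sum_congr rfl fun i _ => ?_
          rw [lintegral_const_mul _ (measurable_distrib_rpow μ g _ _)]
          ring
      _ ≤ K * ∫⁻ s in Ioi (0 : ℝ), S ^ (1 - 1 / p) *
            μ {x | ENNReal.ofReal s < g x} ^ (1 / p) := by
          gcongr with s
          refine (ENNReal.inner_le_Lp_mul_Lq t _ _ hconj).trans ?_
          simp_rw [hpp, ← ENNReal.rpow_mul]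
          have e1 : (1 - 1 / p) * (p / (p - 1)) = 1 := by
            rw [← hpp]; exact one_div_mul_cancel hconj.pos.ne'
          have e2 : 1 / p * p = 1 := by field_simp
          simp_rw [e1, e2, ENNReal.rpow_one]
          gcongr
          rw [← measure_biUnion_finset (fun i hi j hj hij =>
            (htd hi hj hij).mono inter_subset_right inter_subset_right)
            fun i _ => (hsm s).inter (hBm i)]
          exact measure_mono (iUnion₂_subset fun i _ => inter_subset_left)
      _ = K * N * S ^ (1 - 1 / p) := by
          rw [lintegral_const_mul' _ _ (ENNReal.rpow_ne_top_of_nonneg hpp0.le hSt), ← hN]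
          ring
  rcases eq_or_ne S 0 with hS0 | hS0
  · rw [hS0]; exact zero_le
  rw [← ENNReal.rpow_inv_le_iff hp0, ENNReal.le_div_iff_mul_le (Or.inl hl0) (Or.inl hl)]
  have hSp0 : S ^ (1 - 1 / p) ≠ 0 := by simp [ENNReal.rpow_eq_zero_iff, hS0, hSt]
  have hSpt : S ^ (1 - 1 / p) ≠ ∞ := ENNReal.rpow_ne_top_of_nonneg hpp0.le hSt
  rw [← ENNReal.mul_le_mul_iff_left hSp0 hSpt]
  refine le_trans (le_of_eq ?_) hmain
  rw [mul_comm _ l, mul_assoc, ← ENNReal.rpow_add _ _ hS0 hSt, ← one_div]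
  simp

/-- Under a restricted bound with exponent `p`, the average of `g` over a cube is controlled by its
`L^t(μ)` average for every `t > p`: the bound makes `g` weakly `L^(t/p)` on the cube. -/
theorem RestrictedBound.rpow_setLIntegral_mul_le {μ : Measure (Rn n)} [IsLocallyFiniteMeasure μ]
    {p t : ℝ} (hp : 0 < p) (hpt : p < t) {K : ℝ≥0} (h : RestrictedBound μ p K)
    {g : Rn n → ℝ≥0∞} (hg : Measurable g) (c : Rn n) {R : ℝ} (hR : 0 < R) :
    (∫⁻ y in Metric.closedBall c R, g y) * μ (Metric.closedBall c R) ^ (1 / t) ≤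
      ENNReal.ofReal (t / p / (t / p - 1)) * (K : ℝ≥0∞) ^ (p / t) *
        volume (Metric.closedBall c R) *
        (∫⁻ y in Metric.closedBall c R, g y ^ t ∂μ) ^ (1 / t) := by
  set B := Metric.closedBall c R with hB
  set I := ∫⁻ y in B, g y ^ t ∂μ with hI
  have ht : 0 < t := hp.trans hpt
  have hBm : MeasurableSet B := Metric.isClosed_closedBall.measurableSet
  have hsm : ∀ s : ℝ, MeasurableSet {x | ENNReal.ofReal s < g x} := fun s =>
    measurableSet_lt measurable_const hg
  have hv0 : volume B ≠ 0 := (volume_closedBall_pos c hR).ne'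
  have hv1 : volume B ≠ ∞ := volume_closedBall_ne_top c R
  have hm1 : μ B ≠ ∞ := measure_closedBall_lt_top.ne
  rcases eq_or_ne (μ B) 0 with hm0 | hm0
  · rw [hm0, ENNReal.zero_rpow_of_pos (by positivity), mul_zero]; exact zero_le
  set m := μ B ^ (1 / p) with hm
  have hm0' : m ≠ 0 := by simp [hm, ENNReal.rpow_eq_zero_iff, hm0, hm1]
  have hm1' : m ≠ ∞ := ENNReal.rpow_ne_top_of_nonneg (by positivity) hm1
  have hfin : IsFiniteMeasure (volume.restrict B) := ⟨by simpa using hv1.lt_top⟩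
  have hweak : ∀ s : ℝ, 0 < s → ENNReal.ofReal s ^ (t / p) *
      (volume.restrict B) {x | ENNReal.ofReal s < g x} ≤ K * volume B * I ^ (1 / p) / m := by
    intro s hs
    rw [Measure.restrict_apply (hsm s), ENNReal.le_div_iff_mul_le (Or.inl hm0') (Or.inl hm1'),
      mul_assoc]
    refine (mul_le_mul_right (h c R hR _ ((hsm s).inter hBm) inter_subset_right) _).trans ?_
    rw [mul_left_comm]
    refine mul_le_mul_right ?_ _
    rw [div_eq_mul_one_div t p, ENNReal.rpow_mul, ← ENNReal.mul_rpow_of_nonneg _ _ (by positivity)]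
    refine ENNReal.rpow_le_rpow ?_ (by positivity)
    rw [← Measure.restrict_apply (hsm s)]
    refine le_trans ?_ (mul_meas_ge_le_lintegral (hg.pow_const t) (ENNReal.ofReal s ^ t))
    gcongr with x
    exact fun hx => ENNReal.rpow_le_rpow (le_of_lt hx) ht.le
  have htp : 1 < t / p := by rwa [one_lt_div hp]
  have := lintegral_le_of_weak_bound (volume.restrict B) hg htp hweak
  rw [Measure.restrict_apply_univ, one_div_div, ENNReal.div_rpow_of_nonneg _ _ (by positivity),
    ENNReal.mul_rpow_of_nonneg _ _ (by positivity), ENNReal.mul_rpow_of_nonneg _ _ (by positivity),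
    hm, ← ENNReal.rpow_mul, ← ENNReal.rpow_mul] at this
  have e1 : 1 / p * (p / t) = 1 / t := by field_simp
  rw [e1] at this
  have hmt0 : μ B ^ (1 / t) ≠ 0 := by simp [ENNReal.rpow_eq_zero_iff, hm0, hm1]
  have hmt1 : μ B ^ (1 / t) ≠ ∞ := ENNReal.rpow_ne_top_of_nonneg (by positivity) hm1
  have hvol : volume B ^ (p / t) * volume B ^ (1 - p / t) = volume B := by
    rw [← ENNReal.rpow_add _ _ hv0 hv1]; simp
  refine (mul_le_mul_left this _).trans (le_of_eq ?_)
  rw [ENNReal.div_eq_inv_mul]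
  calc _ = ENNReal.ofReal (t / p / (t / p - 1)) * (K : ℝ≥0∞) ^ (p / t) *
        (volume B ^ (p / t) * volume B ^ (1 - p / t)) * I ^ (1 / t) *
        ((μ B ^ (1 / t))⁻¹ * μ B ^ (1 / t)) := by ring
    _ = _ := by rw [hvol, ENNReal.inv_mul_cancel hmt0 hmt1, mul_one]

/-- The weak type `(t, t)` inequality for the maximal function, for `t > p`. -/
theorem weak_type_avgMax_of_lt (μ : Measure (Rn n)) [IsLocallyFiniteMeasure μ] {p t : ℝ}
    (hp : 0 < p) (hpt : p < t) {K : ℝ≥0} (h : RestrictedBound μ p K) :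
    ∃ C : ℝ≥0∞, C ≠ ∞ ∧ ∀ g : Rn n → ℝ≥0∞, Measurable g → ∀ l : ℝ≥0∞, l ≠ 0 → l ≠ ∞ →
      μ {x | l < avgMax g x} ≤ C * ((∫⁻ y, g y ^ t ∂μ) / l ^ t) := by
  have ht : 0 < t := hp.trans hpt
  set A : ℝ≥0∞ := ENNReal.ofReal (t / p / (t / p - 1)) * (K : ℝ≥0∞) ^ (p / t) with hA
  have hAt : A ≠ ∞ := ENNReal.mul_ne_top ENNReal.ofReal_ne_top
    (ENNReal.rpow_ne_top_of_nonneg (by positivity) ENNReal.coe_ne_top)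
  refine ⟨((K * 5 ^ n : ℝ≥0) : ℝ≥0∞) ^ p * A ^ t, ENNReal.mul_ne_top
    (ENNReal.rpow_ne_top_of_nonneg hp.le ENNReal.coe_ne_top)
    (ENNReal.rpow_ne_top_of_nonneg ht.le hAt), fun g hg l hl0 hl => ?_⟩
  rw [mul_assoc]
  refine measure_lt_avgMax_le μ (fun c R hR => h.doubling hp c hR) g fun T hTd hT => ?_
  have hlt0 : l ^ t ≠ 0 := by simp [ENNReal.rpow_eq_zero_iff, hl0, hl]
  have hltt : l ^ t ≠ ∞ := ENNReal.rpow_ne_top_of_nonneg ht.le hl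
  have hloc : ∀ i ∈ T, μ (Metric.closedBall i.1 i.2) ≤
      A ^ t / l ^ t * ∫⁻ y in Metric.closedBall i.1 i.2, g y ^ t ∂μ := by
    intro i hi
    obtain ⟨hR, hi'⟩ := hT i hi
    have hv0 := (volume_closedBall_pos i.1 hR).ne'
    have hv1 := volume_closedBall_ne_top i.1 i.2
    have h1 := (mul_le_mul_left hi'.le _).trans (h.rpow_setLIntegral_mul_le hp hpt hg i.1 hR)
    rw [← hA, mul_comm l, mul_comm A, mul_assoc, mul_assoc,
      ENNReal.mul_le_mul_iff_right hv0 hv1] at h1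
    have h2 := ENNReal.rpow_le_rpow h1 ht.le
    rw [ENNReal.mul_rpow_of_nonneg _ _ ht.le, ENNReal.mul_rpow_of_nonneg _ _ ht.le,
      ← ENNReal.rpow_mul, ← ENNReal.rpow_mul, one_div_mul_cancel ht.ne', ENNReal.rpow_one,
      ENNReal.rpow_one] at h2
    rw [← ENNReal.mul_div_right_comm, ENNReal.le_div_iff_mul_le (Or.inl hlt0) (Or.inl hltt),
      mul_comm]
    exact h2
  calc ∑ i ∈ T, μ (Metric.closedBall i.1 i.2)
      ≤ ∑ i ∈ T, A ^ t / l ^ t * ∫⁻ y in Metric.closedBall i.1 i.2, g y ^ t ∂μ :=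
        Finset.sum_le_sum hloc
    _ = A ^ t / l ^ t * ∫⁻ y in ⋃ i ∈ T, Metric.closedBall i.1 i.2, g y ^ t ∂μ := by
        rw [← Finset.mul_sum, lintegral_biUnion_finset hTd
          fun i _ => Metric.isClosed_closedBall.measurableSet]
    _ ≤ A ^ t / l ^ t * ∫⁻ y, g y ^ t ∂μ := by
        gcongr; exact Measure.restrict_le_self
    _ = _ := by simp only [div_eq_mul_inv]; ring

/-- Discarding the part of `g` below `l / 2` costs at most `l / 2` in every average. -/
theorem lt_avgMax_indicator {g : Rn n → ℝ≥0∞} (hg : Measurable g) {l : ℝ≥0∞} {x : Rn n}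
    (hx : l < avgMax g x) : l / 2 < avgMax ({y | l / 2 < g y}.indicator g) x := by
  by_contra! hc
  refine absurd hx (not_lt.2 (avgMax_le fun c R hR hxc => ?_))
  have hm : MeasurableSet {y | l / 2 < g y} := measurableSet_lt measurable_const hg
  calc ∫⁻ y in Metric.closedBall c R, g y
      ≤ ∫⁻ y in Metric.closedBall c R, ({y | l / 2 < g y}.indicator g y + l / 2) := by
        refine lintegral_mono fun y => ?_
        by_cases hy : l / 2 < g y
        · rw [indicator_of_mem (by exact hy)]; exact le_self_add
        · exact (not_lt.1 hy).trans le_add_self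
    _ ≤ l / 2 * volume (Metric.closedBall c R) + l / 2 * volume (Metric.closedBall c R) := by
        rw [lintegral_add_right _ measurable_const, setLIntegral_const]
        gcongr
        exact (setLIntegral_le_avgMax_mul _ hR hxc).trans (by gcongr)
    _ = l * volume (Metric.closedBall c R) := by rw [← add_mul, ENNReal.add_halves]

/-- The strong type `(r, r)` inequality for `r > p`, by interpolation between a weak type `(t, t)`
inequality with `p < t < r` and the trivial bound on bounded functions. -/
theorem strong_type_avgMax (μ : Measure (Rn n)) [IsLocallyFiniteMeasure μ] {p r : ℝ}
    (hp : 0 < p) (hpr : p < r) {K : ℝ≥0} (h : RestrictedBound μ p K) :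
    ∃ C : ℝ≥0∞, C ≠ ∞ ∧ ∀ g : Rn n → ℝ≥0∞, Measurable g →
      ∫⁻ x, avgMax g x ^ r ∂μ ≤ C * ∫⁻ x, g x ^ r ∂μ := by
  -- the weak type `(p, p)` itself is not available, so an exponent strictly between is used
  obtain ⟨t, hpt, htr⟩ := exists_between hpr
  have ht : 0 < t := hp.trans hpt
  have hr : 0 < r := hp.trans hpr
  have hrt : 0 < r - t := by linarith
  obtain ⟨C, hC, hweak⟩ := weak_type_avgMax_of_lt μ hp hpt h
  set C' : ℝ≥0∞ := C * ENNReal.ofReal (r * 2 ^ t / (r - t)) with hC'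
  refine ⟨C' * 2 ^ (r - t), ENNReal.mul_ne_top (ENNReal.mul_ne_top hC ENNReal.ofReal_ne_top)
    (ENNReal.rpow_ne_top_of_nonneg hrt.le (by simp)), fun g hg => ?_⟩
  have hlevel : ∀ s ∈ Ioi (0 : ℝ), ENNReal.ofReal (r * s ^ (r - 1)) *
      μ {x | ENNReal.ofReal s < avgMax g x} ≤
      ∫⁻ x, C' * g x ^ t * {s : ℝ | ENNReal.ofReal s < 2 * g x}.indicator
        (fun s => ENNReal.ofReal ((r - t) * s ^ (r - t - 1))) s ∂μ := by
    intro s hs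
    have hs : 0 < s := hs
    set l := ENNReal.ofReal s with hl
    have hl0 : l / 2 ≠ 0 := by simp [hl, hs]
    have hl1 : l / 2 ≠ ∞ := by simp [hl, ENNReal.div_eq_top]
    have hm : MeasurableSet {y | l / 2 < g y} := measurableSet_lt measurable_const hg
    have h1 : μ {x | l < avgMax g x} ≤
        C * ((∫⁻ y, ({y | l / 2 < g y}.indicator g y) ^ t ∂μ) / (l / 2) ^ t) :=
      (measure_mono fun x hx => lt_avgMax_indicator hg hx).trans
        (hweak _ (hg.indicator hm) _ hl0 hl1)
    refine (mul_le_mul_right h1 _).trans ?_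
    rw [div_eq_mul_inv, ← mul_assoc, ← mul_assoc, mul_right_comm, ← lintegral_const_mul _
      ((hg.indicator hm).pow_const t)]
    refine lintegral_mono fun x => ?_
    by_cases hx : l / 2 < g x
    · have hx' : l < 2 * g x := by
        rwa [mul_comm, ← ENNReal.div_lt_iff (by simp) (by simp)]
      rw [indicator_of_mem (by exact hx), indicator_of_mem (by exact hx')]
      refine le_of_eq ?_
      have e : ((l / 2) ^ t)⁻¹ = ENNReal.ofReal ((s / 2) ^ (-t)) := by
        rw [← ENNReal.rpow_neg, hl, ← ENNReal.ofReal_rpow_of_pos (by positivity),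
          ENNReal.ofReal_div_of_pos (by norm_num)]
        norm_num
      rw [e, hC']
      have e2 : ENNReal.ofReal (r * s ^ (r - 1)) * ENNReal.ofReal ((s / 2) ^ (-t)) =
          ENNReal.ofReal (r * 2 ^ t / (r - t)) * ENNReal.ofReal ((r - t) * s ^ (r - t - 1)) := by
        rw [← ENNReal.ofReal_mul (by positivity), ← ENNReal.ofReal_mul (by positivity)]
        congr 1
        have e3 : r - 1 = (r - t - 1) + t := by ring
        rw [e3, Real.rpow_add hs, Real.rpow_neg (by positivity), Real.div_rpow hs.le (by norm_num)]
        field_simp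
      calc _ = C * (ENNReal.ofReal (r * s ^ (r - 1)) * ENNReal.ofReal ((s / 2) ^ (-t))) *
            g x ^ t := by ring
        _ = _ := by rw [e2]; ring
    · rw [indicator_of_notMem (by exact hx), ENNReal.zero_rpow_of_pos ht, mul_zero]
      exact zero_le
  have hmeas : ∀ x, Measurable ({s : ℝ | ENNReal.ofReal s < 2 * g x}.indicator
        (fun s => ENNReal.ofReal ((r - t) * s ^ (r - t - 1)))) := fun x =>
    Measurable.indicator (by fun_prop) (measurableSet_lt (by fun_prop) measurable_const)
  have hloc : SFinite μ := inferInstance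
  rw [lintegral_rpow_eq_lintegral_distrib μ (measurable_avgMax g) hr]
  calc _ ≤ ∫⁻ s in Ioi (0 : ℝ), ∫⁻ x, C' * g x ^ t *
        {s : ℝ | ENNReal.ofReal s < 2 * g x}.indicator
        (fun s => ENNReal.ofReal ((r - t) * s ^ (r - t - 1))) s ∂μ :=
        setLIntegral_mono' measurableSet_Ioi hlevel
    _ = ∫⁻ x, C' * g x ^ t * (2 * g x) ^ (r - t) ∂μ := by
        rw [lintegral_lintegral_swap]
        · refine lintegral_congr fun x => ?_
          rw [lintegral_const_mul _ (hmeas x), lintegral_Ioi_indicator_rpow hrt]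
        · have hS : MeasurableSet {z : ℝ × Rn n | ENNReal.ofReal z.1 < 2 * g z.2} :=
            measurableSet_lt (by fun_prop) (by fun_prop)
          have : Measurable fun z : ℝ × Rn n => C' * g z.2 ^ t *
              {z : ℝ × Rn n | ENNReal.ofReal z.1 < 2 * g z.2}.indicator
                (fun z => ENNReal.ofReal ((r - t) * z.1 ^ (r - t - 1))) z :=
            Measurable.mul (by fun_prop) (Measurable.indicator (by fun_prop) hS)
          exact this.aemeasurable
    _ = C' * 2 ^ (r - t) * ∫⁻ x, g x ^ r ∂μ := by
        rw [← lintegral_const_mul _ (hg.pow_const r)]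
        refine lintegral_congr fun x => ?_
        have e : g x ^ r = g x ^ t * g x ^ (r - t) := by
          rw [← ENNReal.rpow_add_of_nonneg _ _ ht.le hrt.le]; congr 1; ring
        rw [ENNReal.mul_rpow_of_nonneg _ _ hrt.le, e]
        ring

/-! ### Averaging at the scale of the distance to a closed set -/

/-- On the open set `U`, `F` is replaced by its average over the cube centred at the point whose side
length is the distance to the complement of `U`; off `U` it is kept. This plays the part of the
Calderón–Zygmund decomposition. -/
def whitneyAvg (U : Set (Rn n)) (F : Rn n → ℝ≥0∞) (y : Rn n) : ℝ≥0∞ :=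
  open scoped Classical in
  if y ∈ U then (∫⁻ z in Metric.closedBall y (Metric.infDist y Uᶜ / 2), F z) /
    volume (Metric.closedBall y (Metric.infDist y Uᶜ / 2)) else F y

/-- The kernel of the averaging operator `whitneyAvg U`. -/
def whitneyKernel (U : Set (Rn n)) (y z : Rn n) : ℝ≥0∞ :=
  {w : Rn n × Rn n | dist w.2 w.1 ≤ Metric.infDist w.1 Uᶜ / 2}.indicator
    (fun w => (ENNReal.ofReal (Metric.infDist w.1 Uᶜ ^ n))⁻¹) (y, z)

theorem volume_closedBall_infDist (U : Set (Rn n)) (y : Rn n) :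
    volume (Metric.closedBall y (Metric.infDist y Uᶜ / 2)) =
      ENNReal.ofReal (Metric.infDist y Uᶜ ^ n) := by
  rw [volume_closedBall_eq _ (by have := Metric.infDist_nonneg (x := y) (s := Uᶜ); positivity)]
  congr 2; ring

theorem measurable_whitneyKernel (U : Set (Rn n)) :
    Measurable (Function.uncurry (whitneyKernel U)) := by
  have hd : Measurable fun w : Rn n × Rn n => Metric.infDist w.1 Uᶜ :=
    (Metric.continuous_infDist_pt Uᶜ).measurable.comp measurable_fst
  exact Measurable.indicator (hd.pow_const n).ennreal_ofReal.inv
    (measurableSet_le (by fun_prop) (hd.div_const 2))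

theorem whitneyAvg_of_mem {U : Set (Rn n)} {F : Rn n → ℝ≥0∞} (hF : Measurable F) {y : Rn n}
    (hy : y ∈ U) : whitneyAvg U F y = ∫⁻ z, F z * whitneyKernel U y z := by
  rw [whitneyAvg, if_pos hy, volume_closedBall_infDist, div_eq_mul_inv,
    ← lintegral_mul_const _ hF, ← lintegral_indicator Metric.isClosed_closedBall.measurableSet]
  refine lintegral_congr fun z => ?_
  by_cases hz : dist z y ≤ Metric.infDist y Uᶜ / 2
  · rw [indicator_of_mem (by exact hz), whitneyKernel, indicator_of_mem (by exact hz)]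
  · rw [indicator_of_notMem (by exact hz), whitneyKernel, indicator_of_notMem (by exact hz),
      mul_zero]

theorem whitneyAvg_of_notMem {U : Set (Rn n)} {F : Rn n → ℝ≥0∞} {y : Rn n} (hy : y ∉ U) :
    whitneyAvg U F y = F y := if_neg hy

theorem measurable_whitneyAvg {U : Set (Rn n)} (hU : MeasurableSet U) {F : Rn n → ℝ≥0∞}
    (hF : Measurable F) : Measurable (whitneyAvg U F) := by
  classical
  have h1 : Measurable fun y => ∫⁻ z, F z * whitneyKernel U y z :=
    Measurable.lintegral_prod_right' (f := fun w : Rn n × Rn n => F w.2 * whitneyKernel U w.1 w.2)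
      ((hF.comp measurable_snd).mul (measurable_whitneyKernel U))
  have : whitneyAvg U F = fun y => if y ∈ U then ∫⁻ z, F z * whitneyKernel U y z else F y := by
    funext y
    split_ifs with hy
    · exact whitneyAvg_of_mem hF hy
    · exact whitneyAvg_of_notMem hy
  rw [this]
  exact Measurable.ite hU h1 hF

/-- Near `z ∈ U` the kernel has a mass bounded below; this mass sits in the double of every cube
that contains `z` and meets the complement of `U`. -/
theorem one_le_setLIntegral_whitneyKernel {U : Set (Rn n)} (hU : IsOpen U) {c x z : Rn n} {R : ℝ}
    (hx : x ∉ U) (hxc : x ∈ Metric.closedBall c R) (hz : z ∈ Metric.closedBall c R) (hzU : z ∈ U) :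
    1 ≤ ENNReal.ofReal ((5 / 2) ^ n) *
      ∫⁻ y in Metric.closedBall c (2 * R) ∩ U, whitneyKernel U y z := by
  have hne : (Uᶜ).Nonempty := ⟨x, hx⟩
  set d := Metric.infDist z Uᶜ with hd
  have hd0 : 0 < d := (hU.isClosed_compl.notMem_iff_infDist_pos hne).1 (by simpa using hzU)
  have hdR : d ≤ 2 * R := by
    refine (Metric.infDist_le_dist_of_mem (show x ∈ Uᶜ from hx)).trans ?_
    have := dist_triangle_right z x c
    rw [Metric.mem_closedBall] at hxc hz
    linarith
  set V := volume (Metric.closedBall z (d / 4)) with hV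
  have hV0 : V ≠ 0 := (volume_closedBall_pos z (by positivity)).ne'
  have hV1 : V ≠ ∞ := volume_closedBall_ne_top _ _
  have hcomp : ∀ y ∈ Metric.closedBall z (d / 4),
      3 / 4 * d ≤ Metric.infDist y Uᶜ ∧ Metric.infDist y Uᶜ ≤ 5 / 4 * d := by
    intro y hy
    rw [Metric.mem_closedBall] at hy
    have h1 := Metric.infDist_le_infDist_add_dist (s := Uᶜ) (x := z) (y := y)
    have h2 := Metric.infDist_le_infDist_add_dist (s := Uᶜ) (x := y) (y := z)
    rw [dist_comm z y] at h1
    constructor <;> linarith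
  have hsub : Metric.closedBall z (d / 4) ⊆ Metric.closedBall c (2 * R) ∩ U := by
    intro y hy
    refine ⟨?_, ?_⟩
    · rw [Metric.mem_closedBall] at *
      have := dist_triangle y z c
      linarith
    · by_contra hyU
      have : Metric.infDist y Uᶜ = 0 := Metric.infDist_zero_of_mem hyU
      have := (hcomp y hy).1
      linarith
  have hker : ∀ y ∈ Metric.closedBall z (d / 4),
      (ENNReal.ofReal ((5 / 2) ^ n) * V)⁻¹ ≤ whitneyKernel U y z := by
    intro y hy
    obtain ⟨h1, h2⟩ := hcomp y hy
    have hmem : dist z y ≤ Metric.infDist y Uᶜ / 2 := by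
      rw [Metric.mem_closedBall, dist_comm] at hy
      linarith
    rw [whitneyKernel, indicator_of_mem (by exact hmem), ENNReal.inv_le_inv, hV,
      volume_closedBall_eq _ (by positivity), ← ENNReal.ofReal_mul (by positivity), ← mul_pow]
    refine ENNReal.ofReal_le_ofReal ?_
    have := Metric.infDist_nonneg (x := y) (s := Uᶜ)
    gcongr
    linarith
  have h5 : ENNReal.ofReal ((5 / 2 : ℝ) ^ n) ≠ 0 := by
    simp only [ne_eq, ENNReal.ofReal_eq_zero, not_le]; positivity
  calc (1 : ℝ≥0∞) = ENNReal.ofReal ((5 / 2) ^ n) * ((ENNReal.ofReal ((5 / 2) ^ n) * V)⁻¹ * V) := by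
        rw [mul_left_comm, ENNReal.inv_mul_cancel (mul_ne_zero h5 hV0)
          (ENNReal.mul_ne_top ENNReal.ofReal_ne_top hV1)]
    _ = ENNReal.ofReal ((5 / 2) ^ n) *
        ∫⁻ y in Metric.closedBall z (d / 4), (ENNReal.ofReal ((5 / 2) ^ n) * V)⁻¹ := by
        rw [setLIntegral_const]
    _ ≤ ENNReal.ofReal ((5 / 2) ^ n) * ∫⁻ y in Metric.closedBall z (d / 4), whitneyKernel U y z := by
        exact mul_le_mul_right
          (setLIntegral_mono' Metric.isClosed_closedBall.measurableSet hker) _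
    _ ≤ _ := by
        exact mul_le_mul_right (lintegral_mono_set hsub) _

/-- Off `U`, averaging does not decrease the maximal function by more than a constant factor. -/
theorem avgMax_le_avgMax_whitneyAvg {U : Set (Rn n)} (hU : IsOpen U) {F : Rn n → ℝ≥0∞}
    (hF : Measurable F) {x : Rn n} (hx : x ∉ U) :
    avgMax F x ≤ ENNReal.ofReal (5 ^ n) * avgMax (whitneyAvg U F) x := by
  refine avgMax_le fun c R hR hxc => ?_
  set B := Metric.closedBall c R with hB
  set B2 := Metric.closedBall c (2 * R) with hB2
  set A := ENNReal.ofReal ((5 / 2 : ℝ) ^ n) with hA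
  have hBB : B ⊆ B2 := Metric.closedBall_subset_closedBall (by linarith)
  have hA1 : 1 ≤ A := by
    rw [hA, ENNReal.one_le_ofReal]; exact one_le_pow₀ (by norm_num)
  have hin : ∫⁻ z in B ∩ U, F z ≤ A * ∫⁻ y in B2 ∩ U, whitneyAvg U F y := by
    have hk := measurable_whitneyKernel U
    calc ∫⁻ z in B ∩ U, F z
        ≤ ∫⁻ z in B ∩ U, A * ∫⁻ y in B2 ∩ U, F z * whitneyKernel U y z := by
          refine setLIntegral_mono' (Metric.isClosed_closedBall.measurableSet.inter
            hU.measurableSet) fun z hz => ?_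
          have h1 := one_le_setLIntegral_whitneyKernel hU hx hxc hz.1 hz.2
          have hkz : Measurable fun y => whitneyKernel U y z := hk.comp measurable_prodMk_right
          rw [lintegral_const_mul _ hkz, mul_left_comm]
          exact le_mul_of_one_le_right' h1
      _ ≤ ∫⁻ z, A * ∫⁻ y in B2 ∩ U, F z * whitneyKernel U y z :=
          lintegral_mono' Measure.restrict_le_self le_rfl
      _ = A * ∫⁻ y in B2 ∩ U, ∫⁻ z, F z * whitneyKernel U y z := by
          rw [lintegral_const_mul' _ _ ENNReal.ofReal_ne_top, lintegral_lintegral_swap]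
          exact ((hF.comp measurable_fst).mul (hk.comp measurable_swap)).aemeasurable
      _ = A * ∫⁻ y in B2 ∩ U, whitneyAvg U F y := by
          congr 1
          refine setLIntegral_congr_fun (Metric.isClosed_closedBall.measurableSet.inter
            hU.measurableSet) fun y hy => ?_
          exact (whitneyAvg_of_mem hF hy.2).symm
  have hout : ∫⁻ z in B \ U, F z ≤ A * ∫⁻ y in B2 \ U, whitneyAvg U F y := by
    calc ∫⁻ z in B \ U, F z = ∫⁻ z in B \ U, whitneyAvg U F z :=
          setLIntegral_congr_fun (Metric.isClosed_closedBall.measurableSet.diff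
            hU.measurableSet) fun y hy => (whitneyAvg_of_notMem hy.2).symm
      _ ≤ 1 * ∫⁻ y in B2 \ U, whitneyAvg U F y := by
          rw [one_mul]; exact lintegral_mono_set (sdiff_subset_sdiff_left hBB)
      _ ≤ _ := by gcongr
  calc ∫⁻ z in B, F z = (∫⁻ z in B ∩ U, F z) + ∫⁻ z in B \ U, F z :=
        (lintegral_inter_add_sdiff _ _ hU.measurableSet).symm
    _ ≤ A * ((∫⁻ y in B2 ∩ U, whitneyAvg U F y) + ∫⁻ y in B2 \ U, whitneyAvg U F y) := by
        rw [mul_add]; exact add_le_add hin hout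
    _ = A * ∫⁻ y in B2, whitneyAvg U F y := by rw [lintegral_inter_add_sdiff _ _ hU.measurableSet]
    _ ≤ A * (avgMax (whitneyAvg U F) x * volume B2) := by
        gcongr
        exact setLIntegral_le_avgMax_mul _ (by positivity) (hBB hxc)
    _ = _ := by
        rw [hB2, volume_closedBall_mul c hR.le (by norm_num), hA]
        have : (5 : ℝ) ^ n = (5 / 2) ^ n * 2 ^ n := by rw [← mul_pow]; norm_num
        rw [this, ENNReal.ofReal_mul (by positivity)]
        ring

/-- Inside `U` the averages are controlled by the maximal function at a nearest point off `U`. -/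
theorem whitneyAvg_le {U : Set (Rn n)} (hU : IsOpen U) (hne : (Uᶜ).Nonempty) {g : Rn n → ℝ≥0∞}
    {l : ℝ≥0∞} (hg : ∀ x ∉ U, avgMax g x ≤ l) {y : Rn n} (hy : y ∈ U) :
    whitneyAvg U g y ≤ ENNReal.ofReal (2 ^ n) * l := by
  set d := Metric.infDist y Uᶜ with hd
  have hd0 : 0 < d := (hU.isClosed_compl.notMem_iff_infDist_pos hne).1 (by simpa using hy)
  obtain ⟨x, hx, hxd⟩ := hU.isClosed_compl.exists_infDist_eq_dist hne y
  rw [whitneyAvg, if_pos hy]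
  refine ENNReal.div_le_of_le_mul ?_
  calc ∫⁻ z in Metric.closedBall y (d / 2), g z
      ≤ ∫⁻ z in Metric.closedBall y (2 * (d / 2)), g z :=
        lintegral_mono_set (Metric.closedBall_subset_closedBall (by linarith))
    _ ≤ avgMax g x * volume (Metric.closedBall y (2 * (d / 2))) := by
        refine setLIntegral_le_avgMax_mul _ (by positivity) ?_
        rw [Metric.mem_closedBall, dist_comm]; linarith
    _ ≤ l * volume (Metric.closedBall y (2 * (d / 2))) := by gcongr; exact hg x hx
    _ = _ := by
        rw [volume_closedBall_mul y (by positivity) (by norm_num)]; ring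

/-- Minkowski's integral inequality for the `ℓ^r` norm. -/
theorem tsum_lintegral_rpow_le {α : Type*} [MeasurableSpace α] (ν : Measure α) {r : ℝ} (hr : 1 < r)
    {F : ℕ → α → ℝ≥0∞} (hF : ∀ k, Measurable (F k)) :
    (∑' k, (∫⁻ x, F k x ∂ν) ^ r) ^ (1 / r) ≤ ∫⁻ x, (∑' k, F k x ^ r) ^ (1 / r) ∂ν := by
  have hr0 : 0 < r := by linarith
  set J := ∫⁻ x, (∑' k, F k x ^ r) ^ (1 / r) ∂ν with hJ
  rcases eq_or_ne J ∞ with hJt | hJt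
  · rw [hJt]; exact le_top
  set a : ℕ → ℝ≥0∞ := fun k => ∫⁻ x, F k x ∂ν with ha
  have hat : ∀ k, a k ≠ ∞ := by
    intro k
    refine ne_top_of_le_ne_top hJt (lintegral_mono fun x => ?_)
    calc F k x = (F k x ^ r) ^ (1 / r) := by
          rw [← ENNReal.rpow_mul, mul_one_div_cancel hr0.ne', ENNReal.rpow_one]
      _ ≤ _ := by gcongr; exact ENNReal.le_tsum k
  rw [one_div, ENNReal.rpow_inv_le_iff hr0, ENNReal.tsum_eq_iSup_sum]
  refine iSup_le fun T => ?_
  set S := ∑ k ∈ T, a k ^ r with hS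
  have hSt : S ≠ ∞ := by
    rw [hS, ENNReal.sum_ne_top]
    exact fun k _ => ENNReal.rpow_ne_top_of_nonneg hr0.le (hat k)
  rcases eq_or_ne S 0 with hS0 | hS0
  · rw [hS0]; exact zero_le
  have hconj : (r / (r - 1)).HolderConjugate r := (Real.HolderConjugate.conjExponent hr).symm
  have hpp : 1 / (r / (r - 1)) = 1 - 1 / r := by field_simp
  have hpp0 : 0 < 1 - 1 / r := by
    have : 1 / r < 1 := by rw [div_lt_one hr0]; exact hr
    linarith
  -- test against `a k ^ (r - 1)` and apply Hölder's inequality under the integral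
  have hmain : S ≤ S ^ (1 - 1 / r) * J := by
    calc S = ∑ k ∈ T, a k ^ (r - 1) * ∫⁻ x, F k x ∂ν := by
          rw [hS]
          refine Finset.sum_congr rfl fun k _ => ?_
          have : a k ^ r = a k ^ (r - 1) * a k ^ (1 : ℝ) := by
            rw [← ENNReal.rpow_add_of_nonneg _ _ (by linarith) (by norm_num)]; congr 1; ring
          rw [this, ENNReal.rpow_one]
      _ = ∫⁻ x, ∑ k ∈ T, a k ^ (r - 1) * F k x ∂ν := by
          rw [lintegral_finsetSum _ fun k _ => (hF k).const_mul _]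
          refine Finset.sum_congr rfl fun k _ => ?_
          rw [lintegral_const_mul _ (hF k)]
      _ ≤ ∫⁻ x, S ^ (1 - 1 / r) * (∑' k, F k x ^ r) ^ (1 / r) ∂ν := by
          refine lintegral_mono fun x => ?_
          refine (ENNReal.inner_le_Lp_mul_Lq T _ _ hconj).trans ?_
          simp_rw [hpp, ← ENNReal.rpow_mul]
          have e1 : (r - 1) * (r / (r - 1)) = r := by
            have : r - 1 ≠ 0 := by linarith
            field_simp
          rw [e1]
          gcongr
          exact ENNReal.sum_le_tsum T
      _ = _ := lintegral_const_mul' _ _ (ENNReal.rpow_ne_top_of_nonneg hpp0.le hSt)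
  have hSp0 : S ^ (1 - 1 / r) ≠ 0 := by simp [ENNReal.rpow_eq_zero_iff, hS0, hSt]
  have hSpt : S ^ (1 - 1 / r) ≠ ∞ := ENNReal.rpow_ne_top_of_nonneg hpp0.le hSt
  rw [← ENNReal.rpow_inv_le_iff hr0, ← ENNReal.mul_le_mul_iff_right hSp0 hSpt]
  refine le_trans (le_of_eq ?_) hmain
  rw [← ENNReal.rpow_add _ _ hS0 hSt, ← one_div]
  simp

/-- Minkowski's inequality for the averages over one cube. -/
theorem ellr_whitneyAvg_le {U : Set (Rn n)} {r : ℝ} (hr : 1 < r) {F : ℕ → Rn n → ℝ≥0∞}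
    (hF : ∀ k, Measurable (F k)) {y : Rn n} (hy : y ∈ U) :
    ellr r (fun k => whitneyAvg U (F k)) y ≤ whitneyAvg U (ellr r F) y := by
  set V := volume (Metric.closedBall y (Metric.infDist y Uᶜ / 2)) with hV
  have key := tsum_lintegral_rpow_le
    (V⁻¹ • volume.restrict (Metric.closedBall y (Metric.infDist y Uᶜ / 2))) hr hF
  simp only [lintegral_smul_measure, smul_eq_mul] at key
  simp only [ellr, whitneyAvg, if_pos hy]
  simpa only [ENNReal.div_eq_inv_mul, ← hV] using key

/-- A weak form of Lebesgue's differentiation theorem. -/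
theorem ae_le_avgMax {g : Rn n → ℝ≥0∞} (hg : Measurable g) : ∀ᵐ x, g x ≤ avgMax g x := by
  have h : ∀ q : ℚ, ∀ᵐ x, ((q : ℝ).toNNReal : ℝ≥0∞) < g x →
      ((q : ℝ).toNNReal : ℝ≥0∞) ≤ avgMax g x := by
    intro q
    set l : ℝ≥0∞ := ((q : ℝ).toNNReal : ℝ≥0∞) with hl
    have hE : MeasurableSet {x | l < g x} := measurableSet_lt measurable_const hg
    -- `avgMax g ≥ l` at the density points of the superlevel set
    filter_upwards [Besicovitch.ae_tendsto_measure_inter_div_of_measurableSet volume hE] with x hx hlx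
    rw [indicator_of_mem (by exact hlx), Pi.one_apply] at hx
    have h2 := ENNReal.Tendsto.const_mul (a := l) hx (Or.inr ENNReal.coe_ne_top)
    rw [mul_one] at h2
    refine le_of_tendsto h2 ?_
    filter_upwards [self_mem_nhdsWithin] with R hR
    rw [← mul_div_assoc]
    refine ENNReal.div_le_of_le_mul ?_
    refine le_trans ?_ (setLIntegral_le_avgMax_mul g hR (Metric.mem_closedBall_self (le_of_lt hR)))
    calc l * volume ({x | l < g x} ∩ Metric.closedBall x R)
        = ∫⁻ y in {x | l < g x} ∩ Metric.closedBall x R, l := by rw [setLIntegral_const]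
      _ ≤ ∫⁻ y in {x | l < g x} ∩ Metric.closedBall x R, g y :=
          setLIntegral_mono' (hE.inter Metric.isClosed_closedBall.measurableSet)
            fun y hy => le_of_lt hy.1
      _ ≤ _ := lintegral_mono_set inter_subset_right
  filter_upwards [ae_all_iff.2 h] with x hx
  by_contra! hc
  obtain ⟨q, _, h1, h2⟩ := ENNReal.lt_iff_exists_rat_btwn.1 hc
  exact absurd (hx q h2) (not_le.2 h1)

/-! ### The vector-valued weak type inequality -/

/-- `L^{p,1} ⊆ L^p`, in terms of distribution functions. -/
theorem lintegral_rpow_le_lorentz {α : Type*} [MeasurableSpace α] (μ : Measure α) [SFinite μ]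
    {p : ℝ} (hp : 1 < p) {g : α → ℝ≥0∞} (hg : Measurable g) :
    ∫⁻ x, g x ^ p ∂μ ≤ ENNReal.ofReal p *
      (∫⁻ s in Ioi (0 : ℝ), μ {x | ENNReal.ofReal s < g x} ^ (1 / p)) ^ p := by
  have hp0 : 0 < p := by linarith
  set d : ℝ → ℝ≥0∞ := fun s => μ {x | ENNReal.ofReal s < g x} with hd
  have hanti : Antitone d := fun s t h =>
    measure_mono fun x hx => lt_of_le_of_lt (ENNReal.ofReal_le_ofReal h) hx
  set N := ∫⁻ s in Ioi (0 : ℝ), d s ^ (1 / p) with hN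
  have hweak : ∀ s : ℝ, 0 < s → ENNReal.ofReal s * d s ^ (1 / p) ≤ N := by
    intro s hs
    calc ENNReal.ofReal s * d s ^ (1 / p) = ∫⁻ u in Ioc (0 : ℝ) s, d s ^ (1 / p) := by
          rw [setLIntegral_const, Real.volume_Ioc, sub_zero, mul_comm]
      _ ≤ ∫⁻ u in Ioc (0 : ℝ) s, d u ^ (1 / p) :=
          setLIntegral_mono' measurableSet_Ioc fun u hu =>
            ENNReal.rpow_le_rpow (hanti hu.2) (by positivity)
      _ ≤ N := lintegral_mono_set fun u hu => hu.1
  rw [lintegral_rpow_eq_lintegral_distrib μ hg hp0]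
  calc ∫⁻ s in Ioi (0 : ℝ), ENNReal.ofReal (p * s ^ (p - 1)) * d s
      ≤ ∫⁻ s in Ioi (0 : ℝ), ENNReal.ofReal p * N ^ (p - 1) * d s ^ (1 / p) := by
        refine setLIntegral_mono' measurableSet_Ioi fun s hs => ?_
        have hs : 0 < s := hs
        have e1 : d s = (d s ^ (1 / p)) ^ (p - 1) * d s ^ (1 / p) := by
          rw [← ENNReal.rpow_mul, ← ENNReal.rpow_add_of_nonneg _ _
            (mul_nonneg (by positivity) (by linarith)) (by positivity)]
          have : 1 / p * (p - 1) + 1 / p = 1 := by field_simp; ring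
          rw [this, ENNReal.rpow_one]
        calc ENNReal.ofReal (p * s ^ (p - 1)) * d s
            = ENNReal.ofReal p * (ENNReal.ofReal s * d s ^ (1 / p)) ^ (p - 1) *
              d s ^ (1 / p) := by
              rw [ENNReal.mul_rpow_of_nonneg _ _ (by linarith), ENNReal.ofReal_rpow_of_pos hs,
                ENNReal.ofReal_mul hp0.le]
              nth_rewrite 1 [e1]
              ring
          _ ≤ _ := by
              gcongr
              exact hweak s hs
    _ = ENNReal.ofReal p * N ^ p := by
        rw [lintegral_const_mul _ (hanti.measurable.pow_const _), ← hN, mul_assoc]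
        congr 1
        have : N ^ p = N ^ (p - 1) * N ^ (1 : ℝ) := by
          rw [← ENNReal.rpow_add_of_nonneg _ _ (by linarith) (by norm_num)]; congr 1; ring
        rw [this, ENNReal.rpow_one]

theorem measurable_ellr {r : ℝ} {F : ℕ → Rn n → ℝ≥0∞} (hF : ∀ k, Measurable (F k)) :
    Measurable (ellr r F) :=
  (Measurable.tsum fun k => (hF k).pow_const r).pow_const _

theorem ellr_rpow {r : ℝ} (hr : 0 < r) (F : ℕ → Rn n → ℝ≥0∞) (x : Rn n) :
    ellr r F x ^ r = ∑' k, F k x ^ r := by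
  rw [ellr, ← ENNReal.rpow_mul, one_div_mul_cancel hr.ne', ENNReal.rpow_one]

theorem ellr_mul_le {r : ℝ} (hr : 0 < r) {F G : ℕ → Rn n → ℝ≥0∞} {A : ℝ≥0∞} {x : Rn n}
    (h : ∀ k, F k x ≤ A * G k x) : ellr r F x ≤ A * ellr r G x := by
  rw [← ENNReal.rpow_le_rpow_iff hr, ENNReal.mul_rpow_of_nonneg _ _ hr.le, ellr_rpow hr,
    ellr_rpow hr, ← ENNReal.tsum_mul_left]
  refine ENNReal.tsum_le_tsum fun k => ?_
  rw [← ENNReal.mul_rpow_of_nonneg _ _ hr.le]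
  exact ENNReal.rpow_le_rpow (h k) hr.le

/-- The vector-valued restricted weak type inequality. With `U` the superlevel set of the maximal
function of `|F|_r`, which is small by the scalar inequality, the functions `F k` are replaced by
`whitneyAvg U (F k)`; the new sequence is pointwise `O(l)`, so the strong type `(r, r)` inequality
and Chebyshev's inequality apply to it. -/
theorem weak_type_ellr_avgMax (μ : Measure (Rn n)) [IsLocallyFiniteMeasure μ] (hμ : μ ≪ volume)
    {p r : ℝ} (hp : 1 < p) (hpr : p < r) {K : ℝ≥0} (h : RestrictedBound μ p K) :
    ∃ C : ℝ≥0∞, C ≠ ∞ ∧ ∀ F : ℕ → Rn n → ℝ≥0∞, (∀ k, Measurable (F k)) →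
      ∀ l : ℝ≥0∞, l ≠ 0 → l ≠ ∞ →
      μ {x | l < ellr r (fun k => avgMax (F k)) x} ≤ C *
        ((∫⁻ s in Ioi (0 : ℝ), μ {x | ENNReal.ofReal s < ellr r F x} ^ (1 / p)) / l) ^ p := by
  have hp0 : 0 < p := by linarith
  have hr : 1 < r := hp.trans hpr
  have hr0 : 0 < r := by linarith
  have hsf : SFinite μ := inferInstance
  obtain ⟨C2, hC2, hstrong⟩ := strong_type_avgMax μ hp0 hpr h
  set C1 : ℝ≥0∞ := ((K * 5 ^ n : ℝ≥0) : ℝ≥0∞) ^ p * (K : ℝ≥0∞) ^ p with hC1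
  have hC1t : C1 ≠ ∞ := ENNReal.mul_ne_top (ENNReal.rpow_ne_top_of_nonneg hp0.le ENNReal.coe_ne_top)
    (ENNReal.rpow_ne_top_of_nonneg hp0.le ENNReal.coe_ne_top)
  set A : ℝ≥0∞ := ENNReal.ofReal (5 ^ n) with hA
  set A2 : ℝ≥0∞ := ENNReal.ofReal (2 ^ n) with hA2
  refine ⟨C1 + A ^ r * C2 * (A2 ^ r * C1 + ENNReal.ofReal p), ?_, fun F hF l hl0 hl => ?_⟩
  · have h1 : A ^ r ≠ ∞ := ENNReal.rpow_ne_top_of_nonneg hr0.le ENNReal.ofReal_ne_top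
    have h2 : A2 ^ r ≠ ∞ := ENNReal.rpow_ne_top_of_nonneg hr0.le ENNReal.ofReal_ne_top
    finiteness
  set g := ellr r F with hg
  have hgm : Measurable g := measurable_ellr hF
  set N := ∫⁻ s in Ioi (0 : ℝ), μ {x | ENNReal.ofReal s < g x} ^ (1 / p) with hN
  set U := {x | l < avgMax g x} with hU
  have hUo : IsOpen U := isOpen_lt_avgMax g l
  have hUm : MeasurableSet U := hUo.measurableSet
  have hUle : μ U ≤ C1 * (N / l) ^ p := by
    refine (weak_type_avgMax μ hp h hgm hl0 hl).trans (le_of_eq ?_)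
    rw [mul_div_assoc, ENNReal.mul_rpow_of_nonneg _ _ hp0.le, hC1, mul_assoc]
  -- `infDist` to the empty set is a junk value, but then `U` is everything and is already small
  rcases (Uᶜ).eq_empty_or_nonempty with hne | hne
  · have : U = univ := compl_empty_iff.1 hne
    refine (measure_mono (subset_univ _)).trans ?_
    rw [← this, add_mul]
    exact hUle.trans le_self_add
  set H : ℕ → Rn n → ℝ≥0∞ := fun k => whitneyAvg U (F k) with hH
  have hHm : ∀ k, Measurable (H k) := fun k => measurable_whitneyAvg hUm (hF k)
  have hoff : ∀ x ∉ U, avgMax g x ≤ l := fun x hx => not_lt.1 hx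
  have hpt : ∀ᵐ x ∂μ, ellr r H x ^ r ≤
      U.indicator (fun _ => (A2 * l) ^ r) x + l ^ (r - p) * g x ^ p := by
    filter_upwards [hμ.ae_le (ae_le_avgMax hgm)] with x hx
    by_cases hxU : x ∈ U
    · rw [indicator_of_mem hxU]
      refine le_trans (ENNReal.rpow_le_rpow ?_ hr0.le) le_self_add
      exact (ellr_whitneyAvg_le hr hF hxU).trans (whitneyAvg_le hUo hne hoff hxU)
    · rw [indicator_of_notMem hxU, zero_add]
      have e1 : ellr r H x = g x := by
        simp only [hH, hg, ellr, whitneyAvg_of_notMem hxU]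
      have e2 : g x ^ r = g x ^ (r - p) * g x ^ p := by
        rw [← ENNReal.rpow_add_of_nonneg _ _ (by linarith) hp0.le]; congr 1; ring
      rw [e1, e2]
      gcongr
      exact hx.trans (hoff x hxU)
  have hHint : ∫⁻ x, ellr r H x ^ r ∂μ ≤
      l ^ r * ((A2 ^ r * C1 + ENNReal.ofReal p) * (N / l) ^ p) := by
    calc ∫⁻ x, ellr r H x ^ r ∂μ
        ≤ ∫⁻ x, U.indicator (fun _ => (A2 * l) ^ r) x + l ^ (r - p) * g x ^ p ∂μ :=
          lintegral_mono_ae hpt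
      _ = (A2 * l) ^ r * μ U + l ^ (r - p) * ∫⁻ x, g x ^ p ∂μ := by
          rw [lintegral_add_left (measurable_const.indicator hUm),
            lintegral_indicator_const hUm, lintegral_const_mul _ (hgm.pow_const p)]
      _ ≤ (A2 * l) ^ r * (C1 * (N / l) ^ p) + l ^ (r - p) * (ENNReal.ofReal p * N ^ p) := by
          gcongr
          exact lintegral_rpow_le_lorentz μ hp hgm
      _ = _ := by
          have e1 : l ^ (r - p) * N ^ p = l ^ r * (N / l) ^ p := by
            rw [ENNReal.rpow_sub _ _ hl0 hl, ENNReal.div_rpow_of_nonneg _ _ hp0.le,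
              div_eq_mul_inv, div_eq_mul_inv]
            ring
          rw [mul_left_comm (l ^ (r - p)), e1, ENNReal.mul_rpow_of_nonneg _ _ hr0.le]
          ring
  have hMH : ∫⁻ x, ellr r (fun k => avgMax (H k)) x ^ r ∂μ ≤ C2 * ∫⁻ x, ellr r H x ^ r ∂μ := by
    simp_rw [ellr_rpow hr0]
    rw [lintegral_tsum fun k => ((measurable_avgMax _).pow_const r).aemeasurable,
      lintegral_tsum fun k => ((hHm k).pow_const r).aemeasurable, ← ENNReal.tsum_mul_left]
    exact ENNReal.tsum_le_tsum fun k => hstrong _ (hHm k)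
  have hA0 : A ^ r ≠ 0 := by
    simp [ENNReal.rpow_eq_zero_iff, hA]
  have hlr0 : l ^ r ≠ 0 := by simp [ENNReal.rpow_eq_zero_iff, hl0, hl]
  have hlrt : l ^ r ≠ ∞ := ENNReal.rpow_ne_top_of_nonneg hr0.le hl
  set E := {x | l ^ r ≤ A ^ r * ellr r (fun k => avgMax (H k)) x ^ r} with hE
  have hsub : {x | l < ellr r (fun k => avgMax (F k)) x} ⊆ U ∪ E := by
    intro x hx
    by_cases hxU : x ∈ U
    · exact Or.inl hxU
    · right
      rw [hE, mem_ofPred_eq, ← ENNReal.mul_rpow_of_nonneg _ _ hr0.le]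
      refine ENNReal.rpow_le_rpow ((le_of_lt hx).trans ?_) hr0.le
      exact ellr_mul_le hr0 fun k => avgMax_le_avgMax_whitneyAvg hUo (hF k) hxU
  have hEle : μ E ≤ A ^ r * C2 * (A2 ^ r * C1 + ENNReal.ofReal p) * (N / l) ^ p := by
    have hm : Measurable fun x => A ^ r * ellr r (fun k => avgMax (H k)) x ^ r :=
      ((measurable_ellr fun k => measurable_avgMax _).pow_const r).const_mul _
    rw [← ENNReal.mul_le_mul_iff_right hlr0 hlrt]
    calc l ^ r * μ E ≤ ∫⁻ x, A ^ r * ellr r (fun k => avgMax (H k)) x ^ r ∂μ :=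
          mul_meas_ge_le_lintegral hm _
      _ = A ^ r * ∫⁻ x, ellr r (fun k => avgMax (H k)) x ^ r ∂μ :=
          lintegral_const_mul _ ((measurable_ellr fun k => measurable_avgMax _).pow_const r)
      _ ≤ A ^ r * (C2 * (l ^ r * ((A2 ^ r * C1 + ENNReal.ofReal p) * (N / l) ^ p))) := by
          gcongr
          exact hMH.trans (by gcongr)
      _ = _ := by ring
  calc _ ≤ μ U + μ E := (measure_mono hsub).trans (measure_union_le _ _)
    _ ≤ _ := by rw [add_mul]; exact add_le_add hUle hEle

/-! ### The class `A(p,1)` and the restricted bound -/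

theorem IsWeight.isLocallyFiniteMeasure (hω : IsWeight ω) :
    IsLocallyFiniteMeasure (wMeasure ω) := by
  refine ⟨fun x => ?_⟩
  obtain ⟨s, hs, hi⟩ := hω.locallyIntegrable x
  refine ⟨s, hs, ?_⟩
  rw [wMeasure, withDensity_apply']
  exact (lintegral_mono fun y => Real.ofReal_le_enorm (ω y)).trans_lt hi.2

theorem wMeasure_absolutelyContinuous (ω : Rn n → ℝ) : wMeasure ω ≪ volume :=
  withDensity_absolutelyContinuous _ _

theorem IsWeight.aemeasurable (hω : IsWeight ω) : AEMeasurable ω volume :=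
  hω.locallyIntegrable.aestronglyMeasurable.aemeasurable

theorem IsWeight.absolutelyContinuous (hω : IsWeight ω) : volume ≪ wMeasure ω := by
  refine withDensity_absolutelyContinuous' hω.aemeasurable.ennreal_ofReal ?_
  filter_upwards [hω.pos_ae] with x hx
  simpa using hx

theorem IsWeight.measure_closedBall_ne_zero (hω : IsWeight ω) (c : Rn n) {R : ℝ} (hR : 0 < R) :
    wMeasure ω (Metric.closedBall c R) ≠ 0 := fun h =>
  (volume_closedBall_pos c hR).ne' (hω.absolutelyContinuous h)

/-- `∫_E ω⁻¹ dμ = |E|`; the inverse is allowed to be any version `v`, so that a measurable one can be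
used. -/
theorem IsWeight.setLIntegral_inv (hω : IsWeight ω) {v : Rn n → ℝ≥0∞}
    (hv : v =ᵐ[volume] fun x => (ENNReal.ofReal (ω x))⁻¹) {E : Set (Rn n)} (hE : MeasurableSet E) :
    ∫⁻ x in E, v x ∂wMeasure ω = volume E := by
  rw [wMeasure, restrict_withDensity hE, lintegral_withDensity_eq_lintegral_mul_non_measurable₀]
  · rw [← setLIntegral_one]
    refine lintegral_congr_ae (ae_restrict_of_ae ?_)
    filter_upwards [hv, hω.pos_ae] with x hx hpos
    rw [Pi.mul_apply, hx, ENNReal.mul_inv_cancel (by simpa using hpos) ENNReal.ofReal_ne_top]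
  · exact hω.aemeasurable.ennreal_ofReal.restrict
  · exact Filter.Eventually.of_forall fun _ => ENNReal.ofReal_lt_top

theorem lorentzNorm_one_indicator (ω : Rn n → ℝ) {p : ℝ} (hp : 0 < p) (E : Set (Rn n)) :
    lorentzNorm ω p 1 (E.indicator fun _ => 1) = wMeasure ω E ^ (1 / p) := by
  rw [lorentzNorm_one ω hp]
  have h1 := lintegral_Ioi_indicator_rpow one_pos 1
  rw [ENNReal.one_rpow] at h1
  have hm : Measurable ({s : ℝ | ENNReal.ofReal s < 1}.indicator
      fun s => ENNReal.ofReal (1 * s ^ ((1 : ℝ) - 1))) :=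
    Measurable.indicator (by fun_prop) (measurableSet_lt (by fun_prop) measurable_const)
  suffices hs : ∀ s : ℝ, distrib ω (E.indicator fun _ => 1) (ENNReal.ofReal s) ^ (1 / p) =
      wMeasure ω E ^ (1 / p) * {s : ℝ | ENNReal.ofReal s < 1}.indicator
        (fun s => ENNReal.ofReal (1 * s ^ ((1 : ℝ) - 1))) s by
    rw [lintegral_congr hs, lintegral_const_mul _ hm, h1, mul_one]
  intro s
  by_cases hs : ENNReal.ofReal s < 1
  · rw [indicator_of_mem (by exact hs)]
    have : {x | ENNReal.ofReal s < E.indicator (fun _ => (1 : ℝ≥0∞)) x} = E := by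
      ext x
      by_cases hx : x ∈ E <;> simp [hx, hs]
    simp [distrib, this]
  · rw [indicator_of_notMem (by exact hs), mul_zero]
    have : {x | ENNReal.ofReal s < E.indicator (fun _ => (1 : ℝ≥0∞)) x} = ∅ := by
      ext x
      simp only [mem_ofPred_eq, mem_empty_iff_false, iff_false, not_lt]
      exact (indicator_le_self' (fun _ _ => zero_le) x).trans (not_lt.1 hs)
    rw [distrib, this, measure_empty, ENNReal.zero_rpow_of_pos (by positivity)]

theorem distrib_indicator (ω : Rn n → ℝ) {f g : Rn n → ℝ≥0∞} (h : f =ᵐ[volume] g)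
    (Q : Set (Rn n)) (s : ℝ≥0∞) :
    distrib ω (Q.indicator f) s = wMeasure ω ({x | s < g x} ∩ Q) := by
  have h' : Q.indicator f =ᵐ[volume] Q.indicator g := by
    filter_upwards [h] with x hx
    simp only [indicator, hx]
  rw [distrib_congr h', distrib]
  congr 1
  ext x
  by_cases hx : x ∈ Q <;> simp [hx]

/-- Kolmogorov's inequality for `ω⁻¹` on `E` turns the `A(p,1)` condition into a restricted
bound. -/
theorem IsAp1.restrictedBound (hω : IsWeight ω) {p : ℝ} (hp : 1 < p) (h : IsAp1 p ω) :
    ∃ K : ℝ≥0, RestrictedBound (wMeasure ω) p K := by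
  have := hω.isLocallyFiniteMeasure
  have hp0 : 0 < p := by linarith
  have hp1 : 0 < p - 1 := by linarith
  obtain ⟨C, -, hC⟩ := h
  set p' := p / (p - 1) with hp'
  have hp'1 : 1 < p' := by rw [hp', one_lt_div hp1]; linarith
  have hexp : 1 - 1 / p' = 1 / p := by rw [hp']; field_simp; ring
  refine ⟨(p' / (p' - 1)).toNNReal * C, fun c R hR E hE hEQ => ?_⟩
  obtain ⟨v, hvm, hv⟩ := (hω.aemeasurable.ennreal_ofReal.inv : AEMeasurable
    (fun x => (ENNReal.ofReal (ω x))⁻¹) volume)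
  replace hv : (fun x => (ENNReal.ofReal (ω x))⁻¹) =ᵐ[volume] v := hv
  set Q := Metric.closedBall c R with hQ
  have hCQ := hC Q ((isCube_iff _).2 ⟨c, R, hR, rfl⟩)
  set X := lorentzNorm ω p' ∞ (Q.indicator fun x => (ENNReal.ofReal (ω x))⁻¹) with hX
  rw [lorentzNorm_one_indicator ω hp0] at hCQ
  have hXw := (lorentzNorm_top_le_iff ω (by linarith : 0 < p') _ X).1 hX.symm.le
  have hEt : wMeasure ω E ≠ ∞ := ((measure_mono hEQ).trans_lt measure_closedBall_lt_top).ne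
  have hfin : IsFiniteMeasure ((wMeasure ω).restrict E) := ⟨by simpa using hEt.lt_top⟩
  have hK := lintegral_le_of_weak_bound ((wMeasure ω).restrict E) hvm hp'1 (N := X ^ p') (by
    intro s hs
    have h1 := ENNReal.rpow_le_rpow (hXw s hs) (by linarith : 0 ≤ p')
    rw [ENNReal.mul_rpow_of_nonneg _ _ (by linarith), ← ENNReal.rpow_mul,
      one_div_mul_cancel (by linarith), ENNReal.rpow_one, distrib_indicator ω hv] at h1
    refine le_trans ?_ h1
    rw [Measure.restrict_apply (measurableSet_lt measurable_const hvm)]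
    gcongr)
  rw [hω.setLIntegral_inv hv.symm hE, Measure.restrict_apply_univ, hexp, ← ENNReal.rpow_mul,
    mul_one_div_cancel (by linarith), ENNReal.rpow_one] at hK
  calc volume E * wMeasure ω Q ^ (1 / p)
      ≤ ENNReal.ofReal (p' / (p' - 1)) * (X * wMeasure ω E ^ (1 / p)) * wMeasure ω Q ^ (1 / p) := by
        gcongr
    _ = ENNReal.ofReal (p' / (p' - 1)) * (wMeasure ω Q ^ (1 / p) * X) *
        wMeasure ω E ^ (1 / p) := by ring
    _ ≤ ENNReal.ofReal (p' / (p' - 1)) * (C * volume Q) * wMeasure ω E ^ (1 / p) := by gcongr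
    _ = _ := by rw [ENNReal.coe_mul, ← ENNReal.ofReal]; ring

/-- The converse: on `{ω⁻¹ > s}` the measure `ω(x) dx` is at most `s⁻¹` times Lebesgue measure. -/
theorem RestrictedBound.isAp1 (hω : IsWeight ω) {p : ℝ} (hp : 1 < p) {K : ℝ≥0}
    (h : RestrictedBound (wMeasure ω) p K) : IsAp1 p ω := by
  have := hω.isLocallyFiniteMeasure
  have hp0 : 0 < p := by linarith
  have hp1 : 0 < p - 1 := by linarith
  -- `IsAp1` asks for a positive constant
  refine ⟨K + 1, by positivity, fun Q' hQ' => ?_⟩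
  obtain ⟨c, R, hR, rfl⟩ := (isCube_iff Q').1 hQ'
  set Q := Metric.closedBall c R with hQ
  obtain ⟨v, hvm, hv⟩ := (hω.aemeasurable.ennreal_ofReal.inv : AEMeasurable
    (fun x => (ENNReal.ofReal (ω x))⁻¹) volume)
  replace hv : (fun x => (ENNReal.ofReal (ω x))⁻¹) =ᵐ[volume] v := hv
  have hQ0 : wMeasure ω Q ^ (1 / p) ≠ 0 := by
    simp [ENNReal.rpow_eq_zero_iff, hω.measure_closedBall_ne_zero c hR, hp0.le, hQ]
  have hQt : wMeasure ω Q ^ (1 / p) ≠ ∞ :=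
    ENNReal.rpow_ne_top_of_nonneg (by positivity) measure_closedBall_lt_top.ne
  set p' := p / (p - 1) with hp'
  have hp'0 : 0 < p' := div_pos hp0 hp1
  have hexp : 1 / p' + 1 / p = 1 := by rw [hp']; field_simp; ring
  rw [lorentzNorm_one_indicator ω hp0, mul_comm, ← ENNReal.le_div_iff_mul_le (Or.inl hQ0)
    (Or.inl hQt), lorentzNorm_top_le_iff ω hp'0]
  intro s hs
  rw [ENNReal.le_div_iff_mul_le (Or.inl hQ0) (Or.inl hQt), distrib_indicator ω hv]
  set E := {x | ENNReal.ofReal s < v x} ∩ Q with hE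
  have hEm : MeasurableSet E := (measurableSet_lt measurable_const hvm).inter
    Metric.isClosed_closedBall.measurableSet
  rcases eq_or_ne (wMeasure ω E) 0 with hE0 | hE0
  · rw [hE0, ENNReal.zero_rpow_of_pos (by positivity)]; simp
  have hEt : wMeasure ω E ≠ ∞ :=
    ((measure_mono inter_subset_right).trans_lt measure_closedBall_lt_top).ne
  have hsE : ENNReal.ofReal s * wMeasure ω E ≤ volume E := by
    rw [← hω.setLIntegral_inv hv.symm hEm, ← setLIntegral_const]
    exact setLIntegral_mono' hEm fun x hx => le_of_lt hx.1
  have hEp0 : wMeasure ω E ^ (1 / p) ≠ 0 := by simp [ENNReal.rpow_eq_zero_iff, hE0, hEt]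
  have hEpt : wMeasure ω E ^ (1 / p) ≠ ∞ := ENNReal.rpow_ne_top_of_nonneg (by positivity) hEt
  rw [← ENNReal.mul_le_mul_iff_left hEp0 hEpt]
  calc ENNReal.ofReal s * wMeasure ω E ^ (1 / p') * wMeasure ω Q ^ (1 / p) *
        wMeasure ω E ^ (1 / p)
      = ENNReal.ofReal s * wMeasure ω E * wMeasure ω Q ^ (1 / p) := by
        rw [mul_right_comm, mul_assoc (ENNReal.ofReal s), ← ENNReal.rpow_add _ _ hE0 hEt, hexp,
          ENNReal.rpow_one]
    _ ≤ volume E * wMeasure ω Q ^ (1 / p) := by gcongr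
    _ ≤ K * volume Q * wMeasure ω E ^ (1 / p) := h c R hR E hEm inter_subset_right
    _ ≤ _ := by gcongr; exact le_self_add

/-! ### Comparison of the target spaces -/

theorem MaximalBounded.mono {r : ℝ} {MemX MemY MemZ : (Rn n → ℝ≥0∞) → Prop}
    {normX normY normZ : (Rn n → ℝ≥0∞) → ℝ≥0∞} {A : ℝ≥0} (hA : 0 < A)
    (hmem : ∀ G, MemY G → MemZ G) (hnorm : ∀ G, MemY G → normZ G ≤ A * normY G)
    (h : MaximalBounded r MemX normX MemY normY) : MaximalBounded r MemX normX MemZ normZ := by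
  obtain ⟨C, hC, hb⟩ := h
  refine ⟨A * C, by positivity, fun f hf hX => ?_⟩
  obtain ⟨h1, h2, h3⟩ := hb f hf hX
  refine ⟨h1, hmem _ h2, (hnorm _ h2).trans ?_⟩
  rw [ENNReal.coe_mul, mul_assoc]
  gcongr

/-- Kolmogorov's inequality for `G ^ q`, which is in weak `L^{p/q}`. -/
theorem setLIntegral_rpow_le_lorentzNorm_top (hω : IsWeight ω) {p q : ℝ} (hq : 0 < q) (hqp : q < p)
    {G : Rn n → ℝ≥0∞} (hG : AEMeasurable G volume) (c : Rn n) (R : ℝ) :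
    ∫⁻ x in Metric.closedBall c R, G x ^ q ∂wMeasure ω ≤
      ENNReal.ofReal (p / q / (p / q - 1)) * (lorentzNorm ω p ∞ G ^ q *
        wMeasure ω (Metric.closedBall c R) ^ (1 - q / p)) := by
  have := hω.isLocallyFiniteMeasure
  have hp : 0 < p := hq.trans hqp
  obtain ⟨G', hG'm, hG'⟩ := hG
  rw [lorentzNorm_congr hG']
  have hG'' : ∀ᵐ x ∂wMeasure ω, G x = G' x := (wMeasure_absolutelyContinuous ω).ae_le hG'
  have e0 : ∫⁻ x in Metric.closedBall c R, G x ^ q ∂wMeasure ω =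
      ∫⁻ x in Metric.closedBall c R, G' x ^ q ∂wMeasure ω := by
    refine lintegral_congr_ae (ae_restrict_of_ae ?_)
    filter_upwards [hG''] with x hx
    rw [hx]
  rw [e0]
  set X := lorentzNorm ω p ∞ G' with hX
  have hXw := (lorentzNorm_top_le_iff ω hp _ X).1 hX.symm.le
  have hpq : 1 < p / q := by rwa [one_lt_div hq]
  have hfin : IsFiniteMeasure ((wMeasure ω).restrict (Metric.closedBall c R)) :=
    ⟨by simpa using measure_closedBall_lt_top⟩
  have hK := lintegral_le_of_weak_bound ((wMeasure ω).restrict (Metric.closedBall c R))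
    (hG'm.pow_const q) hpq (N := X ^ p) (by
      intro s hs
      have h1 := ENNReal.rpow_le_rpow (hXw (s ^ (1 / q)) (by positivity)) hp.le
      rw [ENNReal.mul_rpow_of_nonneg _ _ hp.le, ← ENNReal.rpow_mul _ (1 / p),
        one_div_mul_cancel hp.ne', ENNReal.rpow_one, ← ENNReal.ofReal_rpow_of_pos hs,
        ← ENNReal.rpow_mul, one_div_mul_eq_div] at h1
      refine le_trans ?_ h1
      gcongr
      refine (Measure.restrict_apply_le _ _).trans (measure_mono fun x hx => ?_)
      rw [mem_ofPred_eq] at *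
      rwa [one_div, ENNReal.rpow_inv_lt_iff hq])
  rwa [one_div_div, Measure.restrict_apply_univ, ← ENNReal.rpow_mul,
    mul_div_cancel₀ _ hp.ne'] at hK

theorem MemLorentz.memLpLoc (hω : IsWeight ω) {p q : ℝ} (hq : 0 < q) (hqp : q < p)
    {G : Rn n → ℝ≥0∞} (hG : MemLorentz ω p ∞ G) : MemLpLoc ω q G := by
  have := hω.isLocallyFiniteMeasure
  refine ⟨hG.1, fun S hS => ?_⟩
  obtain ⟨R, hR⟩ := hS.isBounded.subset_closedBall 0
  refine (lintegral_mono_set hR).trans_lt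
    ((setLIntegral_rpow_le_lorentzNorm_top hω hq hqp hG.1 0 R).trans_lt ?_)
  have hexp : 0 ≤ 1 - q / p := by
    have : q / p ≤ 1 := by rw [div_le_one (hq.trans hqp)]; exact hqp.le
    linarith
  exact ENNReal.mul_lt_top ENNReal.ofReal_lt_top (ENNReal.mul_lt_top
    (ENNReal.rpow_lt_top_of_nonneg hq.le hG.2.ne)
    (ENNReal.rpow_lt_top_of_nonneg hexp measure_closedBall_lt_top.ne))

theorem morreyNorm_le_lorentzNorm_top (hω : IsWeight ω) {p q : ℝ} (hq : 0 < q) (hqp : q < p)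
    {G : Rn n → ℝ≥0∞} (hG : AEMeasurable G volume) :
    morreyNorm ω p q G ≤
      ENNReal.ofReal (p / q / (p / q - 1)) ^ (1 / q) * lorentzNorm ω p ∞ G := by
  refine iSup₂_le fun Q hQ => ?_
  obtain ⟨c, R, hR, rfl⟩ := (isCube_iff Q).1 hQ
  rw [one_div, ENNReal.rpow_inv_le_iff hq, ENNReal.mul_rpow_of_nonneg _ _ hq.le,
    ← ENNReal.rpow_mul, inv_mul_cancel₀ hq.ne', ENNReal.rpow_one]
  refine ENNReal.div_le_of_le_mul ?_
  rw [mul_assoc]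
  exact setLIntegral_rpow_le_lorentzNorm_top hω hq hqp hG c R

theorem weakMorreyNorm_le_morreyNorm (ω : Rn n → ℝ) {p q : ℝ} (hq : 0 < q)
    {G : Rn n → ℝ≥0∞} (hG : AEMeasurable G volume) :
    weakMorreyNorm ω p q G ≤ morreyNorm ω p q G := by
  refine iSup₂_mono fun Q hQ => ?_
  obtain ⟨c, R, hR, rfl⟩ := (isCube_iff Q).1 hQ
  have hexp : (1 - q / p) * (1 / q) = 1 / q - 1 / p := by field_simp
  rw [ENNReal.div_rpow_of_nonneg _ _ (by positivity), ← ENNReal.rpow_mul, hexp]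
  gcongr
  refine iSup₂_le fun s hs => ?_
  rw [← ENNReal.rpow_le_rpow_iff hq, ENNReal.mul_rpow_of_nonneg _ _ hq.le, ← ENNReal.rpow_mul,
    ← ENNReal.rpow_mul, one_div_mul_cancel hq.ne', ENNReal.rpow_one, ENNReal.rpow_one]
  refine le_trans ?_ (mul_meas_ge_le_lintegral₀
    (((hG.mono_ac (wMeasure_absolutelyContinuous ω)).pow_const q).restrict) ((s : ℝ≥0∞) ^ q))
  refine mul_le_mul_right ?_ _
  rw [Measure.restrict_apply' Metric.isClosed_closedBall.measurableSet]
  exact measure_mono fun x hx => ⟨ENNReal.rpow_le_rpow (le_of_lt hx.2) hq.le, hx.1⟩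

/-! ### Sufficiency and necessity of the `A(p,1)` condition -/

theorem RestrictedBound.maximalBounded (hω : IsWeight ω) {p r : ℝ} (hp : 1 < p) (hpr : p < r)
    {K : ℝ≥0} (h : RestrictedBound (wMeasure ω) p K) :
    MaximalBounded r (MemLorentz ω p 1) (lorentzNorm ω p 1)
      (MemLorentz ω p ∞) (lorentzNorm ω p ∞) := by
  have := hω.isLocallyFiniteMeasure
  have hp0 : 0 < p := by linarith
  obtain ⟨C, hC, hweak⟩ := weak_type_ellr_avgMax _ (wMeasure_absolutelyContinuous ω) hp hpr h
  set A : ℝ≥0 := (C ^ (1 / p)).toNNReal + 1 with hA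
  have hCA : C ^ (1 / p) ≤ A := by
    rw [hA, ENNReal.coe_add, ENNReal.coe_toNNReal
      (ENNReal.rpow_ne_top_of_nonneg (by positivity) hC)]
    exact le_self_add
  refine ⟨A, by positivity, fun f hf hX => ?_⟩
  choose F hFm hF using fun k => (hf k).enorm
  have hM : ∀ k, maximal (f k) = avgMax (F k) := fun k => by
    rw [maximal_eq_avgMax, avgMax_congr (hF k)]
  have hell : ellr r (fun k x => ‖f k x‖ₑ) =ᵐ[volume] ellr r F := by
    filter_upwards [ae_all_iff.2 hF] with x hx
    simp only [ellr, hx]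
  simp_rw [hM]
  have hm : Measurable (ellr r fun k => avgMax (F k)) :=
    measurable_ellr fun k => measurable_avgMax _
  have hle : lorentzNorm ω p ∞ (ellr r fun k => avgMax (F k)) ≤
      A * lorentzNorm ω p 1 (ellr r fun k x => ‖f k x‖ₑ) := by
    rw [lorentzNorm_top_le_iff ω hp0]
    intro s hs
    have hs0 : ENNReal.ofReal s ≠ 0 := by simpa using hs
    have h1 := ENNReal.rpow_le_rpow (hweak F hFm _ hs0 ENNReal.ofReal_ne_top)
      (by positivity : 0 ≤ 1 / p)
    rw [ENNReal.mul_rpow_of_nonneg _ _ (by positivity), ← ENNReal.rpow_mul _ p,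
      mul_one_div_cancel hp0.ne', ENNReal.rpow_one, ← mul_div_assoc,
      ENNReal.le_div_iff_mul_le (Or.inl hs0) (Or.inl ENNReal.ofReal_ne_top), mul_comm] at h1
    rw [lorentzNorm_congr hell, lorentzNorm_one ω hp0]
    refine h1.trans ?_
    gcongr
    exact le_rfl
  refine ⟨fun k => (measurable_avgMax _).aemeasurable, ⟨hm.aemeasurable, hle.trans_lt ?_⟩, hle⟩
  exact ENNReal.mul_lt_top ENNReal.coe_lt_top hX.2

theorem ellr_single {r : ℝ} (hr : 0 < r) (g : Rn n → ℝ≥0∞) :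
    ellr r (fun k => if k = 0 then g else 0) = g := by
  funext x
  rw [ellr, tsum_eq_single 0]
  · rw [if_pos rfl, ← ENNReal.rpow_mul, mul_one_div_cancel hr.ne', ENNReal.rpow_one]
  · intro k hk
    rw [if_neg hk, Pi.zero_apply, ENNReal.zero_rpow_of_pos hr]

/-- Necessity: the maximal function of `χ_E` is at least `|E| / |Q|` on a cube `Q ⊇ E`. -/
theorem MaximalBounded.restrictedBound (hω : IsWeight ω) {p q r : ℝ} (hp : 0 < p)
    (hr : 0 < r)
    (h : MaximalBounded r (MemLorentz ω p 1) (lorentzNorm ω p 1)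
      (MemWeakMorrey ω p q) (weakMorreyNorm ω p q)) :
    ∃ K : ℝ≥0, RestrictedBound (wMeasure ω) p K := by
  have := hω.isLocallyFiniteMeasure
  obtain ⟨C, -, hb⟩ := h
  refine ⟨C, fun c R hR E hE hEQ => ?_⟩
  set Q := Metric.closedBall c R with hQ
  set g : Rn n → ℝ≥0∞ := E.indicator fun _ => 1 with hg
  set f : ℕ → Rn n → ℂ := fun k => if k = 0 then E.indicator fun _ => 1 else 0 with hf
  have hf1 : (fun k x => ‖f k x‖ₑ) = fun k => if k = 0 then g else 0 := by
    funext k x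
    by_cases hk : k = 0
    · by_cases hx : x ∈ E <;> simp [hf, hg, hk, hx]
    · simp [hf, hk]
  have hf2 : (fun k => maximal (f k)) = fun k => if k = 0 then avgMax g else 0 := by
    funext k
    rw [maximal_eq_avgMax, show (fun x => ‖f k x‖ₑ) = _ from congrFun hf1 k]
    split_ifs with hk
    · rfl
    · funext x
      exact le_antisymm (avgMax_le fun c R _ _ => by simp) zero_le
  have hfm : ∀ k, AEMeasurable (f k) volume := by
    intro k
    simp only [hf]
    split_ifs
    · exact (measurable_const.indicator hE).aemeasurable
    · exact aemeasurable_const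
  have hQt : wMeasure ω Q ≠ ∞ := measure_closedBall_lt_top.ne
  have hQ0 : wMeasure ω Q ≠ 0 := hω.measure_closedBall_ne_zero c hR
  have hEt : wMeasure ω E ≠ ∞ := ne_top_of_le_ne_top hQt (measure_mono hEQ)
  have hmem : MemLorentz ω p 1 (ellr r fun k x => ‖f k x‖ₑ) := by
    rw [hf1, ellr_single hr]
    refine ⟨(measurable_const.indicator hE).aemeasurable, ?_⟩
    rw [hg, lorentzNorm_one_indicator ω hp]
    exact ENNReal.rpow_lt_top_of_nonneg (by positivity) hEt
  obtain ⟨-, -, hle⟩ := hb f hfm hmem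
  rw [hf1, hf2, ellr_single hr, ellr_single hr, hg, lorentzNorm_one_indicator ω hp, ← hg] at hle
  have hv0 := (volume_closedBall_pos c hR).ne'
  have hv1 := volume_closedBall_ne_top c R
  have hpow0 : ∀ a : ℝ, wMeasure ω Q ^ a ≠ 0 := fun a => by
    simp [ENNReal.rpow_eq_zero_iff, hQ0, hQt]
  have hpowt : ∀ a : ℝ, wMeasure ω Q ^ a ≠ ∞ := fun a => by
    simp [ENNReal.rpow_eq_top_iff, hQ0, hQt]
  have hkey : volume E / volume Q ≤
      C * wMeasure ω E ^ (1 / p) / wMeasure ω Q ^ (1 / p) := by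
    refine ENNReal.le_of_forall_nnreal_lt fun s hs => ?_
    rcases eq_or_ne s 0 with rfl | hs0
    · simp
    have hset : {x | x ∈ Q ∧ (s : ℝ≥0∞) < avgMax g x} = Q := by
      ext x
      refine ⟨fun hx => hx.1, fun hx => ⟨hx, hs.trans_le ?_⟩⟩
      refine ENNReal.div_le_of_le_mul ?_
      refine le_trans (le_of_eq ?_) (setLIntegral_le_avgMax_mul g hR hx)
      rw [hg, lintegral_indicator_const hE, one_mul, Measure.restrict_apply hE,
        inter_eq_left.2 hEQ]
    have h1 := (iSup₂_le_iff.1 (le_refl (weakMorreyNorm ω p q (avgMax g)))) Q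
      ((isCube_iff _).2 ⟨c, R, hR, rfl⟩)
    have h2 : (s : ℝ≥0∞) * wMeasure ω Q ^ (1 / q) / wMeasure ω Q ^ (1 / q - 1 / p) ≤
        C * wMeasure ω E ^ (1 / p) := by
      refine le_trans ?_ (h1.trans hle)
      gcongr
      refine le_iSup₂_of_le s hs0.bot_lt ?_
      rw [hset]
    rw [ENNReal.le_div_iff_mul_le (Or.inl (hpow0 _)) (Or.inl (hpowt _))]
    refine le_trans (le_of_eq ?_) h2
    rw [mul_div_assoc, ← ENNReal.rpow_sub _ _ hQ0 hQt]
    congr 2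
    ring
  rw [ENNReal.div_le_iff_le_mul (Or.inl hv0) (Or.inl hv1)] at hkey
  refine (mul_le_mul_left hkey _).trans (le_of_eq ?_)
  rw [mul_right_comm, ENNReal.div_mul_cancel (hpow0 _) (hpowt _)]
  ring

end WeightedMaximal

end

theorem mainTheorem1 (n : ℕ) (hn : 1 ≤ n) (p q r : ℝ) (hq : 1 < q) (hqp : q < p) (hpr : p < r)
    (ω : WeightedMaximal.Rn n → ℝ) (hω : WeightedMaximal.IsWeight ω) :
    List.TFAE [
      WeightedMaximal.IsAp1 p ω,
      WeightedMaximal.MaximalBounded r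
        (WeightedMaximal.MemLorentz ω p 1) (WeightedMaximal.lorentzNorm ω p 1)
        (WeightedMaximal.MemLorentz ω p ∞) (WeightedMaximal.lorentzNorm ω p ∞),
      WeightedMaximal.MaximalBounded r
        (WeightedMaximal.MemLorentz ω p 1) (WeightedMaximal.lorentzNorm ω p 1)
        (WeightedMaximal.MemMorrey ω p q) (WeightedMaximal.morreyNorm ω p q),
      WeightedMaximal.MaximalBounded r
        (WeightedMaximal.MemLorentz ω p 1) (WeightedMaximal.lorentzNorm ω p 1)
        (WeightedMaximal.MemWeakMorrey ω p q) (WeightedMaximal.weakMorreyNorm ω p q)] := by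
  have hq0 : 0 < q := by linarith
  have hp : 1 < p := hq.trans hqp
  tfae_have 1 → 2 := fun h => by
    obtain ⟨K, hK⟩ := h.restrictedBound hω hp
    exact hK.maximalBounded hω hp hpr
  tfae_have 2 → 3 := fun h => by
    set A : ℝ≥0∞ := ENNReal.ofReal (p / q / (p / q - 1)) ^ (1 / q) with hA
    have hAt : A ≠ ∞ := ENNReal.rpow_ne_top_of_nonneg (by positivity) ENNReal.ofReal_ne_top
    have hnorm : ∀ G, WeightedMaximal.MemLorentz ω p ∞ G → WeightedMaximal.morreyNorm ω p q G ≤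
        ((A.toNNReal + 1 : ℝ≥0) : ℝ≥0∞) * WeightedMaximal.lorentzNorm ω p ∞ G := fun G hG => by
      refine (WeightedMaximal.morreyNorm_le_lorentzNorm_top hω hq0 hqp hG.1).trans ?_
      rw [ENNReal.coe_add, ENNReal.coe_toNNReal hAt]
      gcongr
      exact le_self_add
    refine h.mono (A := A.toNNReal + 1) (by positivity) (fun G hG => ?_) hnorm
    exact ⟨hG.memLpLoc hω hq0 hqp,
      (hnorm G hG).trans_lt (ENNReal.mul_lt_top ENNReal.coe_lt_top hG.2)⟩
  tfae_have 3 → 4 := fun h => by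
    have hnorm := fun G (hG : WeightedMaximal.MemMorrey ω p q G) =>
      WeightedMaximal.weakMorreyNorm_le_morreyNorm ω (p := p) hq0 hG.1.1
    refine h.mono one_pos (fun G hG => ⟨hG.1, (hnorm G hG).trans_lt hG.2⟩) fun G hG => ?_
    rw [ENNReal.coe_one, one_mul]
    exact hnorm G hG
  tfae_have 4 → 1 := fun h => by
    obtain ⟨K, hK⟩ := h.restrictedBound hω (by linarith) (by linarith)
    exact hK.isAp1 hω hp
  tfae_finish
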